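/- Let $(\theta_k)_{k\ge 1}$ be positive real numbers. For $n \ge 0$ let $\sigma_n$ be a random permutation in $\mathfrak{S}(n)$ such that $\mathbb{P}[\sigma_n=\sigma]$ is proportional to $\prod_{k\ge1}\theta_k^{m_k(\sigma)}$, where $m_k(\sigma)$ is the number of cycles of length $k$ of $\sigma$ (fixed points being cycles of length $1$), and let $C_n$ be the number of disjoint cycles of $\sigma_n$, fixed points included. Suppose that there are real numbers $0<m<M$, $0<\phi<\frac{\pi}{2}$, $\theta>0$ and $K$ such that: 1. the power series $\mathfrak{P}(\Theta,z)=\sum_{k\ge1}\frac{\theta_k}{k}z^k$ converges near $0$ and extends to a holomorphic function, still denoted $\mathfrak{P}(\Theta,z)$, on $$\Delta(m,M,\phi)=\{z\in\mathbb{C} : |z|<M,\ z\neq m,\ |\arg(z-m)|>\phi\};$$ 2. as $z\to m$ in $\Delta(m,M,\phi)$, $$\mathfrak{P}(\Theta,z)=\theta\log\Big(\frac{1}{1-\frac{z}{m}}\Big)+K+O(|z-m|)$$ (principal branch of the logarithm). Set $\gamma_\theta=\sum_{n\ge1}\big(\frac{\theta}{n+\theta-1}-\theta\log(1+\frac1n)\big)$.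 This series converges, and $\gamma_1$ is the Euler–Mascheroni constant $\gamma$. Let $\lambda_n=\theta\log n+K+\gamma_\theta$. Given a square-summable family of real numbers $A=\{a_1,a_2,\ldots\}$, denote $$\mathfrak{E}(A',w-1)=\prod_{i\ge1}(1+a_i(w-1))\,e^{-a_i(w-1)}.$$ Then $(C_n)_n$ converges mod-Poisson with parameters $\lambda_n$ and Bernoulli asymptotics, with limiting alphabet $$A_\theta=\Big\{\frac{\theta}{\theta+k} : k\ge 0\Big\}=\Big\{1,\frac{\theta}{\theta+1},\frac{\theta}{\theta+2},\ldots\Big\}.$$ That is, $A_\theta$ is square-summable and $\mathbb{E}[w^{C_n}]\,e^{-\lambda_n(w-1)}\to\mathfrak{E}(A_\theta',w-1)$ locally uniformly on some disc $\{|w|<r\}$ with $r>1$. Moreover the convergence happens locally uniformly on $\mathbb{C}$ at speed $O(n^{-1})$: for every compact set $S\subset\mathbb{C}$ there is a constant $C$ such that for all $n\ge1$ and all $w\in S$, $$\Big|\mathbb{E}[w^{C_n}]\,e^{-\lambda_n(w-1)}-\mathfrak{E}(A_\theta',w-1)\Big|\le\frac{C}{n}.$$ -/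

import Mathlib

open Filter Topology MeasureTheory Asymptotics

/-- The function `𝔈(A', z) = ∏ᵢ (1 + aᵢ z) e^{-aᵢ z}` of an alphabet `A = {a₀, a₁, …}`
(an entire function of `z` when `∑ aᵢ² < ∞`; see `multipliable_elemSeries` for the
unconditional convergence of the product). A finite alphabet is padded with zeros. -/
noncomputable def elemSeries (a : ℕ → ℝ) (z : ℂ) : ℂ :=
  ∏' i : ℕ, (1 + (a i : ℂ) * z) * Complex.exp (-((a i : ℂ) * z))

theorem norm_elemFactor_sub_one_le (x : ℂ) (hx : ‖x‖ ≤ 1) :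
    ‖(1 + x) * Complex.exp (-x) - 1‖ ≤ 3 * ‖x‖ ^ 2 := by
  have h1 : ‖Complex.exp (-x) - 1 - (-x)‖ ≤ ‖-x‖ ^ 2 :=
    Complex.norm_exp_sub_one_sub_id_le (by simpa using hx)
  have h2 : (1 + x) * Complex.exp (-x) - 1
      = (1 + x) * (Complex.exp (-x) - 1 - (-x)) - x ^ 2 := by ring
  have h3 : ‖1 + x‖ ≤ 2 := by
    calc ‖1 + x‖ ≤ ‖(1 : ℂ)‖ + ‖x‖ := norm_add_le _ _
      _ ≤ 2 := by rw [norm_one]; linarith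
  rw [norm_neg] at h1
  rw [h2]
  calc _ ≤ ‖(1 + x) * (Complex.exp (-x) - 1 - (-x))‖ + ‖x ^ 2‖ := norm_sub_le _ _
    _ ≤ 2 * ‖x‖ ^ 2 + ‖x‖ ^ 2 := by
        rw [norm_mul, norm_pow]
        gcongr
    _ = 3 * ‖x‖ ^ 2 := by ring

theorem multipliable_elemSeries {a : ℕ → ℝ} (ha : Summable fun i => a i ^ 2) (z : ℂ) :
    Multipliable fun i : ℕ => (1 + (a i : ℂ) * z) * Complex.exp (-((a i : ℂ) * z)) := by
  have hs : Summable fun i => ‖(a i : ℂ) * z‖ ^ 2 := by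
    have := ha.mul_right (‖z‖ ^ 2)
    refine this.congr fun i => ?_
    rw [norm_mul, mul_pow, Complex.norm_real, Real.norm_eq_abs, sq_abs]
  have h1 : ∀ᶠ i in cofinite, ‖(a i : ℂ) * z‖ ≤ 1 := by
    filter_upwards [hs.tendsto_cofinite_zero.eventually (gt_mem_nhds one_pos)] with i hi
    exact (sq_le_one_iff₀ (norm_nonneg _)).1 hi.le
  have h2 : Summable fun i : ℕ =>
      ‖(1 + (a i : ℂ) * z) * Complex.exp (-((a i : ℂ) * z)) - 1‖ := by
    refine Summable.of_norm_bounded_eventually (hs.mul_left 3) ?_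
    filter_upwards [h1] with i hi
    rw [norm_norm]
    exact norm_elemFactor_sub_one_le _ hi
  have h3 := multipliable_one_add_of_summable h2
  exact h3.congr fun i => by ring

/-- The probability generating function `E[w ^ X]` of an `ℕ`-valued random variable, at a
complex argument. -/
noncomputable def probGenFun {Ω : Type*} [MeasurableSpace Ω] (P : Measure Ω) (X : Ω → ℕ)
    (w : ℂ) : ℂ :=
  ∫ ω, w ^ X ω ∂P

/-- The `ℕ`-valued random variables `X n` (each on its own probability space) converge
mod-Poisson with parameters `lam n` and with Bernoulli asymptotics, the limiting alphabet being
the square-summable family `a`: on some disc of radius `r > 1` the generating functions are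
well defined, and locally uniformly
`E[w ^ X n] e^{-lam n (w - 1)} → 𝔈(A', w - 1)`. -/
structure ModPoissonBernoulli {Ω : ℕ → Type*} [∀ n, MeasurableSpace (Ω n)]
    (P : ∀ n, Measure (Ω n)) [∀ n, IsProbabilityMeasure (P n)] (X : ∀ n, Ω n → ℕ)
    (lam : ℕ → ℝ) (a : ℕ → ℝ) : Prop where
  measurable : ∀ n, Measurable (X n)
  summable_sq : Summable fun i => a i ^ 2
  tendsto : ∃ r : ℝ, 1 < r ∧
    (∀ n, ∀ w ∈ Metric.ball (0 : ℂ) r, Integrable (fun ω => w ^ X n ω) (P n)) ∧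
    TendstoLocallyUniformlyOn
      (fun n w => probGenFun (P n) (X n) w * Complex.exp (-((lam n : ℂ) * (w - 1))))
      (fun w => elemSeries a (w - 1)) atTop (Metric.ball (0 : ℂ) r)

/-- The finite set of permutations carries the discrete σ-algebra. -/
instance instMeasurableSpacePermFin (n : ℕ) : MeasurableSpace (Equiv.Perm (Fin n)) := ⊤

/-- The number `m_k(σ)` of cycles of length `k` of `σ` (fixed points are cycles of length 1). -/
def cycleCount {n : ℕ} (σ : Equiv.Perm (Fin n)) (k : ℕ) : ℕ := σ.partition.parts.count k

/-- The number of disjoint cycles of `σ`, fixed points included. -/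
def numCycles {n : ℕ} (σ : Equiv.Perm (Fin n)) : ℕ := σ.partition.parts.card

/-- The weight `∏_{k ≥ 1} (Θ k) ^ {m_k(σ)}`. -/
noncomputable def cycleWeight (Θ : ℕ → ℝ) {n : ℕ} (σ : Equiv.Perm (Fin n)) : ℝ :=
  ∏ k ∈ Finset.Icc 1 n, Θ k ^ cycleCount σ k

theorem cycleWeight_pos {Θ : ℕ → ℝ} (hΘ : ∀ k, 1 ≤ k → 0 < Θ k) {n : ℕ}
    (σ : Equiv.Perm (Fin n)) : 0 < cycleWeight Θ σ :=
  Finset.prod_pos fun k hk => pow_pos (hΘ k (Finset.mem_Icc.1 hk).1) _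

/-- The weighted probability measure on the symmetric group: the probability of `σ` is
proportional to `cycleWeight Θ σ`. -/
noncomputable def weightedPerm (Θ : ℕ → ℝ) (hΘ : ∀ k, 1 ≤ k → 0 < Θ k) (n : ℕ) :
    PMF (Equiv.Perm (Fin n)) :=
  PMF.ofFintype
    (fun σ => ENNReal.ofReal (cycleWeight Θ σ / ∑ τ : Equiv.Perm (Fin n), cycleWeight Θ τ)) <| by
    have hZ : 0 < ∑ τ : Equiv.Perm (Fin n), cycleWeight Θ τ :=
      Finset.sum_pos (fun τ _ => cycleWeight_pos hΘ τ) Finset.univ_nonempty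
    rw [← ENNReal.ofReal_sum_of_nonneg
      (fun σ _ => div_nonneg (cycleWeight_pos hΘ σ).le hZ.le), ← Finset.sum_div,
      div_self hZ.ne', ENNReal.ofReal_one]

/-- The domain `Δ(m, M, φ)`: the disc `|z| < M` with a closed sector at `m` removed. -/
def deltaDomain (m M φ : ℝ) : Set ℂ :=
  {z : ℂ | ‖z‖ < M ∧ z ≠ (m : ℂ) ∧ φ < |Complex.arg (z - (m : ℂ))|}

/-- The `n`-th term, `n = j + 1 ≥ 1`, of the series defining `γ_θ`. -/
noncomputable def gammaTerm (θ : ℝ) (j : ℕ) : ℝ :=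
  θ / (((j + 1 : ℕ) : ℝ) + θ - 1) - θ * Real.log (1 + 1 / ((j + 1 : ℕ) : ℝ))

/-- `γ_θ = ∑_{n ≥ 1} (θ / (n + θ - 1) - θ log (1 + 1 / n))`. -/
noncomputable def gammaConst (θ : ℝ) : ℝ := ∑' j : ℕ, gammaTerm θ j

/-! Grouping permutations by cycle type gives `E[w^{C_n}] = [z^n] exp(w P(z)) / [z^n] exp(P(z))`, so
everything reduces to the Taylor coefficients of `exp(w P)`, uniformly for `‖w‖ ≤ B`. These
coefficients are the numbers `partitionSum`.

After the scaling `z = m u`, the singularity hypothesis reads `exp(w P(mu)) = e^{wK} (1-u)^{-wθ}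
e^{w r(u)}` with `r(u) = O(|1-u|)`. The factor `(1-u)^{-wθ}` has the exact coefficients `∏_{k<n}
(wθ+k) / n!`. The correction `(1-u)^{-wθ} (e^{w r} - 1)` is `O(|1-u|^{1 - θ Re w})`, and contributes
`O(n^{θ Re w - 2})` by transfer (`exists_norm_taylorCoeff_le`, `exists_norm_partitionSum_sub_le`).
Comparing with the exact product rather than with `n^{wθ-1}/Γ(wθ)` avoids any difficulty at the
zeros of `1/Γ`.

Transfer needs no Hankel contour. Enough derivatives make the function blow up at least like
`|1-u|^{-2}`; Cauchy's formula on the circle of radius `n/(n+1)` then applies, since the mean of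
`|1-u|^{-2}` there is known exactly from the Poisson kernel.

The main terms give `∏_{k<n} (wθ+k)/(θ+k) = ∏_{k<n} (1 + θ/(θ+k) (w-1))`. Extracting `exp((w-1)
∑_{k<n} θ/(θ+k))` leaves the partial products of the limit, which converge at speed `1/n`, and the
extracted sum is `θ log n + γ_θ + O(1/n)`. The coefficient errors, divided by the denominator of
order at least `n^{θ-1}` and normalised by a factor of size `n^{θ - θ Re w}`, are also `O(1/n)`. -/

/-! ### Weighted partitions and the cycle index of the symmetric group. -/

open scoped Nat in
/-- The weight `∏ₖ (y k / k) ^ mₖ / mₖ!` of a multiset with multiplicities `mₖ`. -/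
noncomputable def multisetWeight (y : ℕ → ℂ) (s : Multiset ℕ) : ℂ :=
  (s.map fun k => y k / k).prod / ∏ k ∈ s.toFinset, ((s.count k)! : ℂ)

/-- The sum of the weights of the partitions of `n`. -/
noncomputable def partitionSum (y : ℕ → ℂ) (n : ℕ) : ℂ :=
  ∑ p : n.Partition, multisetWeight y p.parts

open scoped Nat in
theorem prod_factorial_count_cons (k : ℕ) (s : Multiset ℕ) :
    ∏ i ∈ (k ::ₘ s).toFinset, (((k ::ₘ s).count i)! : ℂ)
      = (s.count k + 1) * ∏ i ∈ s.toFinset, ((s.count i)! : ℂ) := by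
  have h : ∏ i ∈ s.toFinset, ((s.count i)! : ℂ)
      = ∏ i ∈ insert k s.toFinset, ((s.count i)! : ℂ) := by
    refine Finset.prod_subset (Finset.subset_insert _ _) fun i _ hi => ?_
    rw [Multiset.count_eq_zero_of_notMem (by simpa using hi)]
    simp
  rw [h, Multiset.toFinset_cons, ← Finset.mul_prod_erase _ _ (Finset.mem_insert_self k _),
    ← Finset.mul_prod_erase _ (fun i => ((s.count i)! : ℂ)) (Finset.mem_insert_self k _),
    Multiset.count_cons_self, Nat.factorial_succ, ← mul_assoc]
  congr 1
  · push_cast; ring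
  · refine Finset.prod_congr rfl fun i hi => ?_
    rw [Multiset.count_cons_of_ne (Finset.ne_of_mem_erase hi)]

open scoped Nat in
theorem prod_factorial_count_ne_zero (s : Multiset ℕ) :
    ∏ i ∈ s.toFinset, ((s.count i)! : ℂ) ≠ 0 :=
  Finset.prod_ne_zero_iff.2 fun i _ => by exact_mod_cast Nat.factorial_ne_zero _

/-- An additional part `k` contributes `y k / k` and raises the factorial `mₖ!` to `(mₖ+1)!`; the
prefactor cancels exactly these denominators. -/
theorem mul_multisetWeight_cons (y : ℕ → ℂ) {k : ℕ} (hk : k ≠ 0) (s : Multiset ℕ) :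
    (k * (k ::ₘ s).count k : ℂ) * multisetWeight y (k ::ₘ s) = y k * multisetWeight y s := by
  have h1 := prod_factorial_count_ne_zero s
  have h2 : (s.count k + 1 : ℂ) ≠ 0 := by exact_mod_cast Nat.succ_ne_zero (s.count k)
  have h3 : (k : ℂ) ≠ 0 := by exact_mod_cast hk
  rw [multisetWeight, multisetWeight, prod_factorial_count_cons, Multiset.map_cons,
    Multiset.prod_cons, Multiset.count_cons_self]
  push_cast
  field_simp

/-- Adding a part `k` is a bijection from the partitions of `n - k` onto those of `n` that contain
`k`; the others have multiplicity zero and drop out. -/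
theorem sum_mul_multisetWeight (y : ℕ → ℂ) {n k : ℕ} (hk : k ∈ Finset.Icc 1 n) :
    ∑ p : n.Partition, (k * p.parts.count k : ℂ) * multisetWeight y p.parts
      = y k * partitionSum y (n - k) := by
  obtain ⟨hk1, hkn⟩ := Finset.mem_Icc.1 hk
  rw [partitionSum, Finset.mul_sum]
  symm
  refine Finset.sum_of_injOn
    (fun q : (n - k).Partition => (⟨k ::ₘ q.parts, fun {i} hi => ?_, ?_⟩ : n.Partition))
    ?_ ?_ ?_ ?_
  · rcases Multiset.mem_cons.1 hi with rfl | hi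
    · exact hk1
    · exact q.parts_pos hi
  · rw [Multiset.sum_cons, q.parts_sum]; omega
  · intro p _ q _ h
    exact Nat.Partition.ext (by simpa using h)
  · simp
  · intro p _ hp
    have : k ∉ p.parts := fun hmem => hp ⟨⟨p.parts.erase k,
      fun hi => p.parts_pos (Multiset.mem_of_mem_erase hi), by
        have h1 := Multiset.sum_cons k (p.parts.erase k)
        rw [Multiset.cons_erase hmem, p.parts_sum] at h1
        omega⟩, by simp, Nat.Partition.ext (Multiset.cons_erase hmem)⟩
    rw [Multiset.count_eq_zero_of_notMem this]; simp
  · intro q _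
    exact (mul_multisetWeight_cons y (by omega) _).symm

theorem partitionSum_zero (y : ℕ → ℂ) : partitionSum y 0 = 1 := by
  simp [partitionSum, multisetWeight]

/-- Double counting with `n = ∑ k mₖ`. This is the coefficient form of `H' = Q' H` for `H = exp Q`.
-/
theorem partitionSum_rec (y : ℕ → ℂ) (n : ℕ) :
    n * partitionSum y n = ∑ k ∈ Finset.Icc 1 n, y k * partitionSum y (n - k) := by
  rw [← Finset.sum_congr rfl fun k hk => sum_mul_multisetWeight y hk, Finset.sum_comm,
    partitionSum, Finset.mul_sum]
  refine Finset.sum_congr rfl fun p _ => ?_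
  rw [← Finset.sum_mul]
  congr 1
  have h := p.parts_sum
  rw [Finset.sum_multiset_count_of_subset _ (Finset.Icc 1 n)] at h
  · calc (n : ℂ) = ((∑ k ∈ Finset.Icc 1 n, p.parts.count k • k : ℕ) : ℂ) := by rw [h]
      _ = _ := by push_cast; exact Finset.sum_congr rfl fun k _ => by simp [mul_comm]
  · intro i hi
    have hi := Multiset.mem_toFinset.1 hi
    exact Finset.mem_Icc.2 ⟨p.parts_pos hi, p.le_of_mem_parts hi⟩

theorem partitionSum_smul_pow (y : ℕ → ℂ) (c : ℂ) (n : ℕ) :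
    partitionSum (fun k => y k * c ^ k) n = partitionSum y n * c ^ n := by
  rw [partitionSum, partitionSum, Finset.sum_mul]
  refine Finset.sum_congr rfl fun p _ => ?_
  have h : (p.parts.map fun k => y k * c ^ k / (k : ℂ)).prod
      = (p.parts.map fun k => y k / (k : ℂ)).prod * c ^ n := by
    have hc : (p.parts.map fun k => c ^ k).prod = c ^ p.parts.sum := by
      induction p.parts using Multiset.induction_on with
      | empty => simp
      | cons a s ih => simp [ih, pow_add]
    conv_rhs => enter [2, 2]; rw [← p.parts_sum]
    rw [← hc, ← Multiset.prod_map_mul]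
    exact congrArg _ (Multiset.map_congr rfl fun k _ => by ring)
  rw [multisetWeight, multisetWeight, h]
  ring

-- Bridges two conventions: cycle types omit fixed points, partitions record them as parts `1`. The
-- `r` ones contribute `r!` to the order of the centralizer.
open scoped Nat in
theorem prod_mul_prod_factorial_add_replicate (c : Multiset ℕ) (hc : ∀ i ∈ c, 2 ≤ i) (r : ℕ) :
    (c + Multiset.replicate r 1).prod
        * ∏ i ∈ (c + Multiset.replicate r 1).toFinset, ((c + Multiset.replicate r 1).count i)!
      = r ! * c.prod * ∏ i ∈ c.toFinset, (c.count i)! := by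
  have h1 : 1 ∉ c := fun h => by have := hc 1 h; omega
  have h : ∏ i ∈ (c + Multiset.replicate r 1).toFinset, ((c + Multiset.replicate r 1).count i)!
      = ∏ i ∈ insert 1 c.toFinset, ((c + Multiset.replicate r 1).count i)! := by
    refine Finset.prod_subset (fun i hi => ?_) fun i _ hi => ?_
    · rcases Multiset.mem_add.1 (Multiset.mem_toFinset.1 hi) with hi | hi
      · simp [hi]
      · simp [Multiset.eq_of_mem_replicate hi]
    · rw [Multiset.count_eq_zero_of_notMem fun h => hi (Multiset.mem_toFinset.2 h),
        Nat.factorial_zero]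
  rw [h, Finset.prod_insert (by simpa using h1), Multiset.count_add,
    Multiset.count_eq_zero_of_notMem h1, Multiset.count_replicate_self, Multiset.prod_add,
    Multiset.prod_replicate, one_pow, mul_one, zero_add]
  rw [Finset.prod_congr rfl (g := fun i => (c.count i)!)]
  · ring
  · intro i hi
    have : i ≠ 1 := by rintro rfl; exact h1 (by simpa using hi)
    rw [Multiset.count_add, Multiset.count_replicate, if_neg this.symm, add_zero]

open scoped Nat in
theorem card_filter_partition_eq_mul {α : Type*} [Fintype α] [DecidableEq α]
    (p : (Fintype.card α).Partition) :
    (Finset.univ.filter fun σ : Equiv.Perm α => σ.partition = p).card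
        * (p.parts.prod * ∏ i ∈ p.parts.toFinset, (p.parts.count i)!)
      = (Fintype.card α)! := by
  classical
  -- `c` is the common cycle type, without fixed points, of the permutations with partition `p`.
  set c := p.parts.filter fun i => 2 ≤ i with hc
  have hsplit : p.parts = c + Multiset.replicate (Fintype.card α - c.sum) 1 := by
    have h1 : p.parts = c + Multiset.replicate (p.parts.filter fun i => ¬ 2 ≤ i).card 1 := by
      conv_lhs => rw [← Multiset.filter_add_not (fun i => 2 ≤ i) p.parts]
      congr 1
      refine Multiset.eq_replicate_card.2 fun i hi => ?_
      have := p.parts_pos (Multiset.mem_of_mem_filter hi)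
      have := Multiset.of_mem_filter hi
      omega
    have h2 := congrArg Multiset.sum h1
    rw [p.parts_sum, Multiset.sum_add, Multiset.sum_replicate, smul_eq_mul, mul_one] at h2
    rwa [← Nat.sub_eq_of_eq_add' h2] at h1
  have hc2 : ∀ i ∈ c, 2 ≤ i := fun i hi => Multiset.of_mem_filter hi
  have hcs : c.sum ≤ Fintype.card α := by
    have h2 := congrArg Multiset.sum hsplit
    rw [p.parts_sum, Multiset.sum_add] at h2
    omega
  have hset : (Finset.univ.filter fun σ : Equiv.Perm α => σ.partition = p)
      = Finset.univ.filter fun σ : Equiv.Perm α => σ.cycleType = c := by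
    ext σ
    simp only [Finset.mem_filter, Finset.mem_univ, true_and]
    constructor
    · rintro rfl
      rw [hc, Equiv.Perm.filter_parts_partition_eq_cycleType]
    · intro h
      refine Nat.Partition.ext ?_
      rw [Equiv.Perm.parts_partition, ← Equiv.Perm.sum_cycleType, h]
      exact hsplit.symm
  have h := Equiv.Perm.card_of_cycleType_mul_eq α c
  rw [if_pos ⟨hcs, hc2⟩] at h
  rw [hset, hsplit, prod_mul_prod_factorial_add_replicate c hc2, h]

open scoped Nat in
theorem sum_perm_eq_factorial_mul_partitionSum (y : ℕ → ℂ) (n : ℕ) :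
    ∑ σ : Equiv.Perm (Fin n), (σ.partition.parts.map y).prod = n ! * partitionSum y n := by
  have hn : partitionSum y n = partitionSum y (Fintype.card (Fin n)) := by rw [Fintype.card_fin]
  rw [hn, partitionSum, Finset.mul_sum,
    ← Finset.sum_fiberwise Finset.univ (fun σ : Equiv.Perm (Fin n) => σ.partition)]
  refine Finset.sum_congr rfl fun p _ => ?_
  rw [Finset.sum_congr rfl (g := fun _ => (p.parts.map y).prod)
    fun σ hσ => by rw [(Finset.mem_filter.1 hσ).2], Finset.sum_const, nsmul_eq_mul]
  have h := congrArg (Nat.cast (R := ℂ)) (card_filter_partition_eq_mul p)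
  rw [show (Fintype.card (Fin n))! = (n)! from by rw [Fintype.card_fin]] at h
  push_cast at h
  have h1 := prod_factorial_count_ne_zero p.parts
  have h2 : (p.parts.map fun k => y k / (k : ℂ)).prod * (p.parts.prod : ℂ)
      = (p.parts.map y).prod := by
    have hpos : ∀ i ∈ p.parts, i ≠ 0 := fun i hi => (p.parts_pos hi).ne'
    generalize p.parts = s at hpos
    induction s using Multiset.induction_on with
    | empty => simp
    | cons a s ih =>
      have ha : (a : ℂ) ≠ 0 := by exact_mod_cast hpos a (Multiset.mem_cons_self _ _)
      simp only [Multiset.map_cons, Multiset.prod_cons, Nat.cast_mul]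
      rw [← ih fun i hi => hpos i (Multiset.mem_cons_of_mem hi)]
      field_simp
  rw [← h, ← h2, multisetWeight]
  push_cast
  field_simp

theorem ofReal_cycleWeight_mul_pow (Θ : ℕ → ℝ) {n : ℕ} (σ : Equiv.Perm (Fin n)) (w : ℂ) :
    (cycleWeight Θ σ : ℂ) * w ^ numCycles σ
      = (σ.partition.parts.map fun k => w * (Θ k : ℂ)).prod := by
  rw [Multiset.prod_map_mul, Multiset.map_const', Multiset.prod_replicate, numCycles, mul_comm,
    cycleWeight, Finset.prod_multiset_map_count]
  congr 1
  push_cast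
  symm
  refine Finset.prod_subset (fun i hi => ?_) fun i _ hi => ?_
  · have hi := Multiset.mem_toFinset.1 hi
    have := σ.partition.le_of_mem_parts hi
    rw [Fintype.card_fin] at this
    exact Finset.mem_Icc.2 ⟨σ.partition.parts_pos hi, this⟩
  · rw [Multiset.count_eq_zero_of_notMem (by simpa using hi), pow_zero]

theorem probGenFun_weightedPerm_eq_sum (Θ : ℕ → ℝ) (hΘ : ∀ k, 1 ≤ k → 0 < Θ k) (n : ℕ) (w : ℂ) :
    probGenFun (weightedPerm Θ hΘ n).toMeasure numCycles w
      = (∑ σ : Equiv.Perm (Fin n), (cycleWeight Θ σ : ℂ) * w ^ numCycles σ)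
        / ∑ σ : Equiv.Perm (Fin n), (cycleWeight Θ σ : ℂ) := by
  have hZ : 0 < ∑ τ : Equiv.Perm (Fin n), cycleWeight Θ τ :=
    Finset.sum_pos (fun τ _ => cycleWeight_pos hΘ τ) Finset.univ_nonempty
  rw [probGenFun, PMF.integral_eq_sum, Finset.sum_div]
  refine Finset.sum_congr rfl fun σ _ => ?_
  rw [weightedPerm, PMF.ofFintype_apply,
    ENNReal.toReal_ofReal (div_nonneg (cycleWeight_pos hΘ σ).le hZ.le), Complex.real_smul]
  push_cast
  ring

theorem probGenFun_weightedPerm (Θ : ℕ → ℝ) (hΘ : ∀ k, 1 ≤ k → 0 < Θ k) (n : ℕ) (w : ℂ) :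
    probGenFun (weightedPerm Θ hΘ n).toMeasure numCycles w
      = partitionSum (fun k => w * Θ k) n / partitionSum (fun k => 1 * Θ k) n := by
  have h : ∑ σ : Equiv.Perm (Fin n), (cycleWeight Θ σ : ℂ)
      = ∑ σ : Equiv.Perm (Fin n), (cycleWeight Θ σ : ℂ) * 1 ^ numCycles σ := by simp
  rw [probGenFun_weightedPerm_eq_sum, h]
  simp only [ofReal_cycleWeight_mul_pow, sum_perm_eq_factorial_mul_partitionSum]
  rw [mul_div_mul_left _ _ (by exact_mod_cast Nat.factorial_ne_zero n)]

/-! ### Exponential formula: Taylor coefficients of `exp Q`. -/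

theorem hasFPowerSeriesAt_of_eventually_hasSum {y : ℕ → ℂ} {Q : ℂ → ℂ}
    (hQ : ∀ᶠ u in 𝓝 (0 : ℂ),
      HasSum (fun j : ℕ => y (j + 1) / ((j + 1 : ℕ) : ℂ) * u ^ (j + 1)) (Q u)) :
    HasFPowerSeriesAt Q (FormalMultilinearSeries.ofScalars ℂ fun k => y k / (k : ℂ)) 0 := by
  rw [hasFPowerSeriesAt_iff]
  filter_upwards [hQ] with u hu
  rw [zero_add, ← hasSum_nat_add_iff' 1]
  simpa [mul_comm, FormalMultilinearSeries.coeff_ofScalars] using hu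

open scoped Nat in
theorem HasFPowerSeriesAt.iteratedDeriv_eq_ofScalars {c : ℕ → ℂ} {Q : ℂ → ℂ}
    (hQ : HasFPowerSeriesAt Q (FormalMultilinearSeries.ofScalars ℂ c) 0) (n : ℕ) :
    iteratedDeriv n Q 0 = n ! * c n := by
  obtain ⟨r, hr⟩ := hQ
  have h := hr.factorial_smul 1 n
  rw [iteratedFDeriv_apply_eq_iteratedDeriv_mul_prod, Finset.prod_const_one, one_smul] at h
  rw [← h, nsmul_eq_mul]
  simp [FormalMultilinearSeries.ofScalars]

-- With `H = exp Q`, the Leibniz rule applied to `H' = Q' H` at `0` reproduces the recurrence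
-- `partitionSum_rec`, so strong induction identifies the coefficients.
open scoped Nat in
theorem iteratedDeriv_exp_comp_eq_partitionSum {y : ℕ → ℂ} {Q : ℂ → ℂ}
    (hQ : ∀ᶠ u in 𝓝 (0 : ℂ),
      HasSum (fun j : ℕ => y (j + 1) / ((j + 1 : ℕ) : ℂ) * u ^ (j + 1)) (Q u)) (n : ℕ) :
    iteratedDeriv n (fun u => Complex.exp (Q u)) 0 = n ! * partitionSum y n := by
  have hps := hasFPowerSeriesAt_of_eventually_hasSum hQ
  have han : AnalyticAt ℂ Q 0 := hps.analyticAt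
  have hQ0 : Q 0 = 0 := by
    have := hps.iteratedDeriv_eq_ofScalars 0
    simpa using this
  have hH : AnalyticAt ℂ (fun u => Complex.exp (Q u)) 0 := han.cexp
  have hderiv : deriv (fun u => Complex.exp (Q u))
      =ᶠ[𝓝 0] deriv Q * fun u => Complex.exp (Q u) := by
    filter_upwards [han.eventually_analyticAt] with u hu
    rw [deriv_cexp hu.differentiableAt, Pi.mul_apply, mul_comm]
  induction n using Nat.strong_induction_on with
  | _ n ih =>
    rcases n with _ | n
    · simp [hQ0, partitionSum_zero]
    rw [iteratedDeriv_succ', hderiv.iteratedDeriv_eq n,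
      iteratedDeriv_mul han.deriv.contDiffAt hH.contDiffAt]
    have hterm : ∀ i ∈ Finset.range (n + 1),
        (n.choose i : ℂ) * iteratedDeriv i (deriv Q) 0
          * iteratedDeriv (n - i) (fun u => Complex.exp (Q u)) 0
        = n ! * (y (i + 1) * partitionSum y (n + 1 - (i + 1))) := by
      intro i hi
      have hi : i ≤ n := by simpa [Nat.lt_succ_iff] using hi
      rw [← iteratedDeriv_succ', hps.iteratedDeriv_eq_ofScalars, ih (n - i) (by omega),
        Nat.add_sub_add_right, Nat.factorial_succ]
      have h1 : (n.choose i : ℂ) * i ! * (n - i)! = n ! := by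
        exact_mod_cast Nat.choose_mul_factorial_mul_factorial hi
      have h2 : ((i + 1 : ℕ) : ℂ) ≠ 0 := by exact_mod_cast Nat.succ_ne_zero i
      rw [← h1]
      push_cast at h2 ⊢
      field_simp
    rw [Finset.sum_congr rfl hterm, ← Finset.mul_sum, Nat.factorial_succ]
    have hsum : ∑ i ∈ Finset.range (n + 1), y (i + 1) * partitionSum y (n + 1 - (i + 1))
        = ∑ k ∈ Finset.Icc 1 (n + 1), y k * partitionSum y (n + 1 - k) := by
      rw [Finset.range_eq_Ico,
        Finset.sum_Ico_add' (fun k => y k * partitionSum y (n + 1 - k)) 0 (n + 1) 1]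
      rfl
    rw [hsum, ← partitionSum_rec]
    push_cast
    ring

/-! ### The binomial function `(1-u)^{-α}` and its coefficients. -/

open Complex in
theorem hasDerivAt_exp_mul_log_one_sub (α : ℂ) {u : ℂ} (hu : 1 - u ∈ slitPlane) :
    HasDerivAt (fun u => exp (-α * log (1 - u))) (α * exp (-(α + 1) * log (1 - u))) u := by
  have h1 : HasDerivAt (fun u : ℂ => 1 - u) (-1) u := by
    simpa using (hasDerivAt_id u).const_sub 1
  have h2 := ((h1.clog hu).const_mul (-α)).cexp
  refine h2.congr_deriv ?_
  have hne : 1 - u ≠ 0 := slitPlane_ne_zero hu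
  have : exp (-(α + 1) * log (1 - u)) = exp (-α * log (1 - u)) / (1 - u) := by
    rw [show -(α + 1) * log (1 - u) = -α * log (1 - u) - log (1 - u) by ring, exp_sub,
      exp_log hne]
  rw [this]
  field_simp

theorem one_sub_mem_slitPlane_of_norm_lt_one {u : ℂ} (hu : ‖u‖ < 1) :
    1 - u ∈ Complex.slitPlane := by
  left
  have := (Complex.re_le_norm u).trans_lt hu
  simpa using this

open Complex in
theorem iteratedDeriv_exp_mul_log_one_sub (α : ℂ) (n : ℕ) :
    Set.EqOn (iteratedDeriv n fun u => exp (-α * log (1 - u)))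
      (fun u => (∏ k ∈ Finset.range n, (α + k)) * exp (-(α + n) * log (1 - u)))
      (Metric.ball 0 1) := by
  induction n with
  | zero => intro u _; simp
  | succ n ih =>
    intro u hu
    have h1 : iteratedDeriv n (fun u => exp (-α * log (1 - u))) =ᶠ[𝓝 u]
        fun u => (∏ k ∈ Finset.range n, (α + k)) * exp (-(α + n) * log (1 - u)) :=
      ih.eventuallyEq_of_mem (Metric.isOpen_ball.mem_nhds hu)
    have hs := one_sub_mem_slitPlane_of_norm_lt_one (by simpa using hu)
    rw [iteratedDeriv_succ, h1.deriv_eq,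
      ((hasDerivAt_exp_mul_log_one_sub (α + n) hs).const_mul _).deriv, Finset.prod_range_succ]
    push_cast
    ring_nf

/-! ### The limiting product, the constant `γ_θ`, and their rates of convergence. -/

/-- Telescoping with `1/(x+1)² ≤ 1/x - 1/(x+1)`. It supplies the `1/n` rate for both the partial
products and the partial sums of `γ_θ`. -/
theorem norm_sub_le_of_norm_succ_sub_le {E : Type*} [SeminormedAddCommGroup E] {d : ℕ → E} {C : ℝ}
    (hC : 0 ≤ C) (hd : ∀ n, ‖d (n + 1) - d n‖ ≤ C / ((n : ℝ) + 1) ^ 2) {L : E}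
    (hL : Tendsto d atTop (𝓝 L)) {n : ℕ} (hn : 1 ≤ n) : ‖d n - L‖ ≤ C / n := by
  have hn0 : (0 : ℝ) < n := by exact_mod_cast hn
  have key : ∀ j : ℕ, ‖d n - d (n + j)‖ ≤ C / n - C / (n + j : ℕ) := by
    intro j
    induction j with
    | zero => simp
    | succ j ih =>
      have hx : (0 : ℝ) < (n + j : ℕ) := by push_cast; positivity
      have h1 : C / (((n + j : ℕ) : ℝ) + 1) ^ 2
          ≤ C / (n + j : ℕ) - C / (n + (j + 1) : ℕ) := by
        have : C / (n + j : ℕ) - C / (n + (j + 1) : ℕ)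
            = C / (((n + j : ℕ) : ℝ) * (((n + j : ℕ) : ℝ) + 1)) := by
          rw [← add_assoc, Nat.cast_add_one (n + j)]
          field_simp
          ring
        rw [this]
        refine div_le_div_of_nonneg_left hC (by positivity) ?_
        nlinarith
      calc ‖d n - d (n + (j + 1))‖
          = ‖(d n - d (n + j)) - (d (n + j + 1) - d (n + j))‖ := by
            rw [add_assoc]; congr 1; abel
        _ ≤ ‖d n - d (n + j)‖ + ‖d (n + j + 1) - d (n + j)‖ := norm_sub_le _ _
        _ ≤ _ := by linarith [hd (n + j)]
  have hlim : Tendsto (fun j => ‖d n - d (n + j)‖) atTop (𝓝 ‖d n - L‖) := by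
    refine (tendsto_const_nhds.sub ?_).norm
    simpa [add_comm] using (tendsto_add_atTop_iff_nat n).2 hL
  refine le_of_tendsto hlim (Eventually.of_forall fun j => (key j).trans ?_)
  have : 0 ≤ C / ((n + j : ℕ) : ℝ) := by positivity
  linarith

/-- For small `x` this is the second-order estimate; for `‖x‖ ≥ 1` a crude bound suffices, since
`‖x‖ ^ 2 ≥ 1` absorbs it. -/
theorem norm_elemFactor_sub_one_le_of_norm_le {x : ℂ} {X : ℝ} (hx : ‖x‖ ≤ X) :
    ‖(1 + x) * Complex.exp (-x) - 1‖ ≤ ((1 + X) * Real.exp X + 3) * ‖x‖ ^ 2 := by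
  have hX : 0 ≤ X := (norm_nonneg x).trans hx
  have hE : 0 ≤ (1 + X) * Real.exp X := by positivity
  rcases le_total ‖x‖ 1 with h | h
  · refine (norm_elemFactor_sub_one_le x h).trans ?_
    gcongr
    linarith
  · have h1 : ‖(1 + x) * Complex.exp (-x)‖ ≤ (1 + X) * Real.exp X := by
      rw [norm_mul]
      gcongr
      · refine (norm_add_le _ _).trans ?_
        rw [norm_one]; gcongr
      · refine (Complex.norm_exp_le_exp_norm _).trans ?_
        rw [norm_neg]; gcongr
    have h2 : 1 ≤ ‖x‖ ^ 2 := one_le_pow₀ h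
    calc _ ≤ ‖(1 + x) * Complex.exp (-x)‖ + ‖(1 : ℂ)‖ := norm_sub_le _ _
      _ ≤ ((1 + X) * Real.exp X + 3) * 1 := by rw [norm_one]; linarith
      _ ≤ _ := by gcongr

theorem div_add_le_div_succ {θ : ℝ} (hθ : 0 < θ) (k : ℕ) :
    θ / (θ + k) ≤ (1 + θ) / ((k : ℝ) + 1) := by
  rw [div_le_div_iff₀ (by positivity) (by positivity)]
  have : (0 : ℝ) ≤ k := k.cast_nonneg
  nlinarith [sq_nonneg θ]

theorem summable_one_div_succ_sq (C : ℝ) : Summable fun n : ℕ => C / ((n : ℝ) + 1) ^ 2 := by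
  have h := (summable_nat_add_iff 1).2 (Real.summable_one_div_nat_pow.2 one_lt_two)
  refine (h.mul_left C).congr fun n => ?_
  push_cast
  ring

theorem summable_sq_div_add {θ : ℝ} (hθ : 0 < θ) :
    Summable fun k : ℕ => (θ / (θ + k)) ^ 2 := by
  refine Summable.of_nonneg_of_le (fun k => by positivity) (fun k => ?_)
    (summable_one_div_succ_sq ((1 + θ) ^ 2))
  rw [← div_pow]
  have := div_add_le_div_succ hθ k
  gcongr

/-- The partial products of the limiting function of the alphabet `θ / (θ + k)`. -/
noncomputable def elemPartial (θ : ℝ) (n : ℕ) (z : ℂ) : ℂ :=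
  ∏ k ∈ Finset.range n, (1 + ((θ / (θ + k) : ℝ) : ℂ) * z)
    * Complex.exp (-(((θ / (θ + k) : ℝ) : ℂ) * z))

theorem exists_norm_elemFactor_sub_one_le {θ : ℝ} (hθ : 0 < θ) (B : ℝ) :
    ∃ C, 0 ≤ C ∧ ∀ (k : ℕ) (z : ℂ), ‖z‖ ≤ B →
      ‖(1 + ((θ / (θ + k) : ℝ) : ℂ) * z) * Complex.exp (-(((θ / (θ + k) : ℝ) : ℂ) * z)) - 1‖
        ≤ C / ((k : ℝ) + 1) ^ 2 := by
  set X := (1 + θ) * |B| with hXdef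
  have hX : 0 ≤ X := by positivity
  refine ⟨((1 + X) * Real.exp X + 3) * X ^ 2, by positivity, fun k z hz => ?_⟩
  have hz : ‖z‖ ≤ |B| := hz.trans (le_abs_self B)
  have h1 : ‖((θ / (θ + k) : ℝ) : ℂ) * z‖ ≤ X / ((k : ℝ) + 1) := by
    rw [norm_mul, Complex.norm_real, Real.norm_of_nonneg (by positivity), hXdef,
      mul_div_right_comm]
    exact mul_le_mul (div_add_le_div_succ hθ k) hz (norm_nonneg _) (by positivity)
  have h2 : X / ((k : ℝ) + 1) ≤ X := div_le_self hX (by linarith [k.cast_nonneg (α := ℝ)])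
  refine (norm_elemFactor_sub_one_le_of_norm_le (h1.trans h2)).trans ?_
  rw [mul_div_assoc, ← div_pow]
  gcongr

theorem exists_norm_elemPartial_le {θ : ℝ} (hθ : 0 < θ) (B : ℝ) :
    ∃ C, 0 ≤ C ∧ ∀ (n : ℕ) (z : ℂ), ‖z‖ ≤ B → ‖elemPartial θ n z‖ ≤ C := by
  obtain ⟨C, hC, h⟩ := exists_norm_elemFactor_sub_one_le hθ B
  refine ⟨Real.exp (∑' n : ℕ, C / ((n : ℝ) + 1) ^ 2), by positivity, fun n z hz => ?_⟩
  rw [elemPartial, norm_prod]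
  calc _ ≤ ∏ k ∈ Finset.range n, Real.exp (C / ((k : ℝ) + 1) ^ 2) := by
        refine Finset.prod_le_prod (fun _ _ => norm_nonneg _) fun k _ => ?_
        have h1 := norm_le_norm_add_norm_sub' ((1 + ((θ / (θ + k) : ℝ) : ℂ) * z)
          * Complex.exp (-(((θ / (θ + k) : ℝ) : ℂ) * z))) 1
        rw [norm_one] at h1
        have := Real.add_one_le_exp (C / ((k : ℝ) + 1) ^ 2)
        linarith [h k z hz]
    _ ≤ _ := by
        rw [← Real.exp_sum]
        exact Real.exp_le_exp.2 ((summable_one_div_succ_sq C).sum_le_tsum _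
          fun k _ => by positivity)

theorem tendsto_elemPartial {θ : ℝ} (hθ : 0 < θ) (z : ℂ) :
    Tendsto (fun n => elemPartial θ n z) atTop
      (𝓝 (elemSeries (fun k => θ / (θ + k)) z)) :=
  (multipliable_elemSeries (summable_sq_div_add hθ) z).hasProd.tendsto_prod_nat

/-- Consecutive partial products differ by a bounded product times (new factor minus one), which is
`O(1/k²)` because the linear terms cancel. -/
theorem exists_norm_elemPartial_sub_elemSeries_le {θ : ℝ} (hθ : 0 < θ) (B : ℝ) :
    ∃ C, 0 ≤ C ∧ ∀ (n : ℕ) (z : ℂ), 1 ≤ n → ‖z‖ ≤ B →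
      ‖elemPartial θ n z - elemSeries (fun k => θ / (θ + k)) z‖ ≤ C / n := by
  obtain ⟨C, hC, h⟩ := exists_norm_elemFactor_sub_one_le hθ B
  obtain ⟨D, hD, h'⟩ := exists_norm_elemPartial_le hθ B
  refine ⟨D * C, by positivity, fun n z hn hz => ?_⟩
  refine norm_sub_le_of_norm_succ_sub_le (d := fun n => elemPartial θ n z) (by positivity)
    (fun k => ?_) (tendsto_elemPartial hθ z) hn
  have : elemPartial θ (k + 1) z - elemPartial θ k z = elemPartial θ k z *
      ((1 + ((θ / (θ + k) : ℝ) : ℂ) * z) * Complex.exp (-(((θ / (θ + k) : ℝ) : ℂ) * z)) - 1) := by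
    rw [elemPartial, elemPartial, Finset.prod_range_succ]
    ring
  rw [this, norm_mul, mul_div_assoc]
  exact mul_le_mul (h' k z hz) (h k z hz) (norm_nonneg _) hD

theorem abs_gammaTerm_le {θ : ℝ} (hθ : 0 < θ) (j : ℕ) :
    |gammaTerm θ j| ≤ (|θ - 1| * (1 + θ) + θ) / ((j : ℝ) + 1) ^ 2 := by
  set x : ℝ := 1 / ((j : ℝ) + 1) with hx
  have hj : (0 : ℝ) < (j : ℝ) + 1 := by positivity
  have hx0 : 0 < x := by positivity
  have hlog1 : Real.log (1 + x) ≤ x := by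
    have := Real.log_le_sub_one_of_pos (show 0 < 1 + x by positivity); linarith
  have hlog2 : x - x ^ 2 ≤ Real.log (1 + x) := by
    refine le_trans ?_ (Real.one_sub_inv_le_log_of_pos (show 0 < 1 + x by positivity))
    rw [le_sub_iff_add_le, ← le_sub_iff_add_le', inv_le_iff_one_le_mul₀ (by positivity)]
    nlinarith [pow_pos hx0 3]
  -- Isolates the two sources of size `1/(j+1)²`: the shift of the denominator from `j+1` to `j+θ`,
  -- and the quadratic remainder of the logarithm.
  have hsplit : gammaTerm θ j
      = (1 - θ) * (θ / (θ + j)) * x + θ * (x - Real.log (1 + x)) := by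
    have hne : θ + (j : ℝ) ≠ 0 := by positivity
    rw [gammaTerm]
    push_cast
    rw [show (j : ℝ) + 1 + θ - 1 = θ + j by ring, ← hx, mul_sub]
    have : θ / (θ + j) = (1 - θ) * (θ / (θ + j)) * x + θ * x := by
      rw [hx]; field_simp; ring
    linarith
  rw [hsplit]
  calc _ ≤ |(1 - θ) * (θ / (θ + j)) * x| + |θ * (x - Real.log (1 + x))| := abs_add_le _ _
    _ ≤ |θ - 1| * ((1 + θ) * x) * x + θ * x ^ 2 := by
        gcongr
        · rw [abs_mul, abs_mul, abs_sub_comm, abs_of_pos hx0,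
            abs_of_nonneg (show 0 ≤ θ / (θ + j) by positivity)]
          have := div_add_le_div_succ hθ j
          rw [div_eq_mul_one_div (1 + θ)] at this
          gcongr
        · rw [abs_mul, abs_of_pos hθ, abs_of_nonneg (by linarith)]
          gcongr
          linarith
    _ = _ := by rw [hx]; field_simp

theorem summable_gammaTerm {θ : ℝ} (hθ : 0 < θ) : Summable (gammaTerm θ) :=
  Summable.of_norm_bounded (summable_one_div_succ_sq _) fun j => abs_gammaTerm_le hθ j

theorem sum_gammaTerm (θ : ℝ) (n : ℕ) :
    ∑ j ∈ Finset.range n, gammaTerm θ j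
      = ∑ j ∈ Finset.range n, θ / (θ + j) - θ * Real.log ((n : ℝ) + 1) := by
  induction n with
  | zero => simp
  | succ n ih =>
    rw [Finset.sum_range_succ, Finset.sum_range_succ, ih, gammaTerm]
    push_cast
    have h : Real.log (1 + 1 / ((n : ℝ) + 1)) = Real.log ((n : ℝ) + 1 + 1) - Real.log ((n : ℝ) + 1) := by
      rw [← Real.log_div (by positivity) (by positivity)]
      congr 1
      field_simp
    rw [h, show (n : ℝ) + 1 + θ - 1 = θ + n by ring]
    ring

theorem gammaConst_one : gammaConst 1 = Real.eulerMascheroniConstant := by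
  refine tendsto_nhds_unique (summable_gammaTerm one_pos).hasSum.tendsto_sum_nat ?_
  refine Real.tendsto_eulerMascheroniSeq.congr fun n => ?_
  rw [sum_gammaTerm, Real.eulerMascheroniSeq, harmonic]
  push_cast
  simp [add_comm]

theorem exists_abs_sum_sub_log_sub_gammaConst_le {θ : ℝ} (hθ : 0 < θ) :
    ∃ C, 0 ≤ C ∧ ∀ n : ℕ, 1 ≤ n →
      |∑ j ∈ Finset.range n, θ / (θ + j) - θ * Real.log n - gammaConst θ| ≤ C / n := by
  set C := |θ - 1| * (1 + θ) + θ
  have hC : 0 ≤ C := by positivity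
  -- The logarithms in `γ_θ` telescope to `log (n+1)`; the extra `θ` pays for replacing it by `log
  -- n`.
  refine ⟨C + θ, by positivity, fun n hn => ?_⟩
  have hn0 : (0 : ℝ) < n := by exact_mod_cast hn
  have h1 : ‖∑ j ∈ Finset.range n, gammaTerm θ j - gammaConst θ‖ ≤ C / n := by
    refine norm_sub_le_of_norm_succ_sub_le (d := fun n => ∑ j ∈ Finset.range n, gammaTerm θ j) hC
      (fun j => ?_) (summable_gammaTerm hθ).hasSum.tendsto_sum_nat hn
    rw [Finset.sum_range_succ, add_sub_cancel_left]
    exact abs_gammaTerm_le hθ j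
  rw [sum_gammaTerm, Real.norm_eq_abs] at h1
  have hlog : Real.log ((n : ℝ) + 1) - Real.log n = Real.log (1 + 1 / n) := by
    rw [← Real.log_div (by positivity) (by positivity)]
    congr 1
    field_simp
  have hlog1 : Real.log (1 + 1 / (n : ℝ)) ≤ 1 / n := by
    have := Real.log_le_sub_one_of_pos (show 0 < 1 + 1 / (n : ℝ) by positivity); linarith
  have hlog2 : 0 ≤ Real.log (1 + 1 / (n : ℝ)) :=
    Real.log_nonneg (by linarith [show 0 < 1 / (n : ℝ) by positivity])
  have h2 : |θ * Real.log (1 + 1 / (n : ℝ))| ≤ θ / n := by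
    have := mul_le_mul_of_nonneg_left hlog1 hθ.le
    rwa [mul_one_div, ← abs_of_nonneg (by positivity : 0 ≤ θ * Real.log (1 + 1 / (n : ℝ)))] at this
  calc _ = |(∑ j ∈ Finset.range n, θ / (θ + j) - θ * Real.log ((n : ℝ) + 1) - gammaConst θ)
        + θ * Real.log (1 + 1 / n)| := by rw [← hlog]; congr 1; ring
    _ ≤ _ := abs_add_le _ _
    _ ≤ C / n + θ / n := add_le_add h1 h2
    _ = _ := by ring

/-- Since `(wθ+k)/(θ+k) = 1 + θ/(θ+k) (w-1)`, the alphabet appears by itself; the last exponential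
undoes the convergence factors. -/
theorem prod_mul_add_div_prod_add {θ : ℝ} (hθ : 0 < θ) (n : ℕ) (w : ℂ) :
    (∏ k ∈ Finset.range n, (w * θ + k)) / (∏ k ∈ Finset.range n, ((θ : ℂ) + k))
      = elemPartial θ n (w - 1)
        * Complex.exp ((w - 1) * ((∑ k ∈ Finset.range n, θ / (θ + k) : ℝ) : ℂ)) := by
  rw [elemPartial, Finset.prod_mul_distrib, ← Complex.exp_sum, mul_assoc, ← Complex.exp_add]
  have : ∑ k ∈ Finset.range n, -(((θ / (θ + k) : ℝ) : ℂ) * (w - 1))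
      + (w - 1) * ((∑ k ∈ Finset.range n, θ / (θ + k) : ℝ) : ℂ) = 0 := by
    push_cast
    rw [Finset.mul_sum, ← Finset.sum_add_distrib]
    exact Finset.sum_eq_zero fun k _ => by ring
  rw [this, Complex.exp_zero, mul_one, ← Finset.prod_div_distrib]
  refine Finset.prod_congr rfl fun k _ => ?_
  have : (θ : ℂ) + k ≠ 0 := by
    exact_mod_cast (show θ + (k : ℝ) ≠ 0 by positivity)
  push_cast
  field_simp
  ring

theorem norm_exp_sub_one_le_mul_exp (x : ℂ) :
    ‖Complex.exp x - 1‖ ≤ ‖x‖ * Real.exp ‖x‖ := by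
  simpa using Complex.norm_exp_sub_sum_le_norm_mul_exp x 1

theorem exists_norm_ratio_mul_exp_sub_elemSeries_le {θ : ℝ} (hθ : 0 < θ) (B : ℝ) :
    ∃ C, 0 ≤ C ∧ ∀ (n : ℕ) (w : ℂ), 1 ≤ n → ‖w - 1‖ ≤ B →
      ‖(∏ k ∈ Finset.range n, (w * θ + k)) / (∏ k ∈ Finset.range n, ((θ : ℂ) + k))
          * Complex.exp (-(w - 1) * ((θ * Real.log n + gammaConst θ : ℝ) : ℂ))
        - elemSeries (fun k => θ / (θ + k)) (w - 1)‖ ≤ C / n := by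
  obtain ⟨C₁, hC₁, h₁⟩ := exists_norm_elemPartial_le hθ B
  obtain ⟨C₂, hC₂, h₂⟩ := exists_norm_elemPartial_sub_elemSeries_le hθ B
  obtain ⟨C₃, hC₃, h₃⟩ := exists_abs_sum_sub_log_sub_gammaConst_le hθ
  refine ⟨C₁ * (|B| * C₃ * Real.exp (|B| * C₃)) + C₂, by positivity, fun n w hn hw => ?_⟩
  have hn1 : (1 : ℝ) ≤ n := by exact_mod_cast hn
  set ε := ∑ j ∈ Finset.range n, θ / (θ + j) - θ * Real.log n - gammaConst θ with hε
  have hx : ‖(w - 1) * (ε : ℂ)‖ ≤ |B| * C₃ / n := by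
    rw [norm_mul, Complex.norm_real, Real.norm_eq_abs, mul_div_assoc]
    exact mul_le_mul (hw.trans (le_abs_self B)) (h₃ n hn) (abs_nonneg _) (abs_nonneg _)
  have hx' : |B| * C₃ / n ≤ |B| * C₃ := div_le_self (by positivity) hn1
  have hexp : ‖Complex.exp ((w - 1) * (ε : ℂ)) - 1‖
      ≤ |B| * C₃ / n * Real.exp (|B| * C₃) := by
    refine (norm_exp_sub_one_le_mul_exp _).trans ?_
    gcongr
    exact hx.trans hx'
  rw [prod_mul_add_div_prod_add hθ, mul_assoc, ← Complex.exp_add]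
  have : (w - 1) * ((∑ k ∈ Finset.range n, θ / (θ + k) : ℝ) : ℂ)
      + -(w - 1) * ((θ * Real.log n + gammaConst θ : ℝ) : ℂ) = (w - 1) * (ε : ℂ) := by
    rw [hε]; push_cast; ring
  rw [this]
  calc _ = ‖elemPartial θ n (w - 1) * (Complex.exp ((w - 1) * (ε : ℂ)) - 1)
        + (elemPartial θ n (w - 1) - elemSeries (fun k => θ / (θ + k)) (w - 1))‖ := by
        congr 1; ring
    _ ≤ C₁ * (|B| * C₃ / n * Real.exp (|B| * C₃)) + C₂ / n := by
        refine (norm_add_le _ _).trans (add_le_add ?_ (h₂ n _ hn hw))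
        rw [norm_mul]
        exact mul_le_mul (h₁ n _ hw) hexp (norm_nonneg _) hC₁
    _ = _ := by ring

/-! ### Geometry of the domain and the remainder at the singularity. -/

/-- Cosine decreases on `[0, π]`. This trades the argument for an inequality between continuous
functions. -/
theorem lt_abs_arg_iff {φ : ℝ} (hφ₀ : 0 ≤ φ) (hφ₁ : φ ≤ Real.pi) {x : ℂ} (hx : x ≠ 0) :
    φ < |Complex.arg x| ↔ x.re < Real.cos φ * ‖x‖ := by
  rw [← div_lt_iff₀ (norm_pos_iff.2 hx), ← Complex.cos_arg hx, ← Real.cos_abs (Complex.arg x)]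
  exact (Real.strictAntiOn_cos.lt_iff_gt ⟨abs_nonneg _, Complex.abs_arg_le_pi x⟩
    ⟨hφ₀, hφ₁⟩).symm

theorem deltaDomain_eq {m M φ : ℝ} (hφ₀ : 0 ≤ φ) (hφ₁ : φ ≤ Real.pi) :
    deltaDomain m M φ = {z : ℂ | ‖z‖ < M} ∩ {z : ℂ | z ≠ m}
      ∩ {z : ℂ | (z - m).re < Real.cos φ * ‖z - m‖} := by
  ext z
  simp only [deltaDomain, Set.mem_ofPred_eq, Set.mem_inter_iff, and_assoc]
  refine and_congr_right fun _ => and_congr_right fun hz => ?_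
  exact lt_abs_arg_iff hφ₀ hφ₁ (sub_ne_zero.2 hz)

theorem isOpen_deltaDomain {m M φ : ℝ} (hφ₀ : 0 ≤ φ) (hφ₁ : φ ≤ Real.pi) :
    IsOpen (deltaDomain m M φ) := by
  rw [deltaDomain_eq hφ₀ hφ₁]
  refine ((isOpen_lt continuous_norm continuous_const).inter isOpen_ne).inter
    (isOpen_lt ?_ ?_)
  · exact Complex.continuous_re.comp (continuous_id.sub continuous_const)
  · fun_prop

/-- On the cut, `v - 1` would be a nonnegative real, equal to its own modulus, against the sector
condition. -/
theorem one_sub_mem_slitPlane_of_mem_deltaDomain {m M φ : ℝ} (hm : 0 < m) (hφ₀ : 0 ≤ φ)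
    (hφ₁ : φ ≤ Real.pi) {v : ℂ} (hv : (m : ℂ) * v ∈ deltaDomain m M φ) :
    1 - v ∈ Complex.slitPlane := by
  rw [deltaDomain_eq hφ₀ hφ₁] at hv
  obtain ⟨-, hv⟩ := hv
  have h1 : (m : ℂ) * v - m = m * (v - 1) := by ring
  rw [Set.mem_ofPred_eq, h1, norm_mul, Complex.norm_real, Real.norm_of_nonneg hm.le,
    Complex.re_ofReal_mul, mul_left_comm, mul_lt_mul_iff_right₀ hm] at hv
  rw [Complex.mem_slitPlane_iff]
  by_contra! h
  obtain ⟨hre, him⟩ := h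
  have h2 : v - 1 = ((v - 1).re : ℂ) := by
    refine Complex.ext rfl ?_
    simpa using him
  have h3 : 0 ≤ (v - 1).re := by
    simp only [Complex.sub_re, Complex.one_re] at hre ⊢; linarith
  have h4 : ‖v - 1‖ = (v - 1).re := by
    conv_lhs => rw [h2]
    rw [Complex.norm_real, Real.norm_of_nonneg h3]
  rw [h4] at hv
  nlinarith [Real.cos_le_one φ]

/-- From `Re u ≤ 1` one gets `Re (v-1) ≤ c ‖1-u‖`, while `‖v-1‖ ≥ (1-c) ‖1-u‖`; `hcφ` makes these
meet the sector condition and `hcM` keeps `m v` in the disc. -/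
theorem mul_mem_deltaDomain {m M φ c : ℝ} (hm : 0 < m) (hφ₀ : 0 ≤ φ) (hφ₁ : φ ≤ Real.pi)
    (hcos : 0 ≤ Real.cos φ) (hc₀ : 0 ≤ c) (hc₁ : c < 1) (hcφ : c < Real.cos φ * (1 - c))
    (hcM : m * (1 + 2 * c) < M) {u v : ℂ} (hu : ‖u‖ ≤ 1) (hu1 : u ≠ 1)
    (hv : ‖v - u‖ ≤ c * ‖1 - u‖) : (m : ℂ) * v ∈ deltaDomain m M φ := by
  have hd : 0 < ‖1 - u‖ := norm_pos_iff.2 (sub_ne_zero.2 hu1.symm)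
  have hd2 : ‖1 - u‖ ≤ 2 := by
    refine (norm_sub_le _ _).trans ?_
    rw [norm_one]; linarith
  have hv1 : (1 - c) * ‖1 - u‖ ≤ ‖v - 1‖ := by
    have : ‖1 - u‖ ≤ ‖v - u‖ + ‖v - 1‖ := by
      rw [show (1 : ℂ) - u = (v - u) - (v - 1) by ring]; exact norm_sub_le _ _
    linarith
  have h1 : (m : ℂ) * v - m = m * (v - 1) := by ring
  rw [deltaDomain_eq hφ₀ hφ₁]
  refine ⟨⟨?_, ?_⟩, ?_⟩
  · have : ‖v‖ ≤ 1 + 2 * c := by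
      have h2 : ‖v‖ ≤ ‖v - u‖ + ‖u‖ := by
        simpa using norm_add_le (v - u) u
      nlinarith
    rw [Set.mem_ofPred_eq, norm_mul, Complex.norm_real, Real.norm_of_nonneg hm.le]
    exact (mul_le_mul_of_nonneg_left this hm.le).trans_lt hcM
  · intro h
    rw [← sub_eq_zero, h1] at h
    have h3 : v - 1 = 0 := (mul_eq_zero.1 h).resolve_left (by exact_mod_cast hm.ne')
    rw [h3, norm_zero] at hv1
    nlinarith
  · rw [Set.mem_ofPred_eq, h1, norm_mul, Complex.norm_real, Real.norm_of_nonneg hm.le,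
      Complex.re_ofReal_mul, mul_left_comm, mul_lt_mul_iff_right₀ hm]
    have h3 : (v - 1).re ≤ c * ‖1 - u‖ := by
      have h4 := (Complex.re_le_norm (v - u)).trans hv
      have h5 := (Complex.re_le_norm u).trans hu
      simp only [Complex.sub_re, Complex.one_re] at h4 ⊢
      linarith
    calc _ ≤ c * ‖1 - u‖ := h3
      _ < Real.cos φ * (1 - c) * ‖1 - u‖ := by gcongr
      _ ≤ _ := by rw [mul_assoc]; gcongr

/-- The union over the closed unit disc of closed discs around `u ≠ 1` of radius `c * ‖1 - u‖`. -/
def coneDomain (c : ℝ) : Set ℂ :=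
  {v | ∃ u : ℂ, ‖u‖ ≤ 1 ∧ u ≠ 1 ∧ ‖v - u‖ ≤ c * ‖1 - u‖}

theorem isCompact_coneDomain_diff_ball {c ε : ℝ} (hc : 0 < c) (hε : 0 < ε) :
    IsCompact (coneDomain c ∩ {v | ε ≤ ‖v - 1‖}) := by
  -- This parametrisation is defined on a compact set. Its only extra parameters, `u = 1`, are sent
  -- to `1`, which the condition `ε ≤ ‖v - 1‖` excludes.
  set W : Set ℂ := (fun p : ℂ × ℂ => p.1 + c * p.2 * (1 - p.1)) ''
    (Metric.closedBall 0 1 ×ˢ Metric.closedBall 0 1) with hW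
  have hWc : IsCompact W :=
    ((isCompact_closedBall _ _).prod (isCompact_closedBall _ _)).image (by fun_prop)
  have : coneDomain c ∩ {v | ε ≤ ‖v - 1‖} = W ∩ {v | ε ≤ ‖v - 1‖} := by
    ext v
    refine and_congr_left fun hv => ⟨?_, ?_⟩
    · rintro ⟨u, hu, hu1, hvu⟩
      have hne : (1 - u) ≠ 0 := sub_ne_zero.2 hu1.symm
      have hcne : (c : ℂ) ≠ 0 := by exact_mod_cast hc.ne'
      refine ⟨(u, (v - u) / (c * (1 - u))), ⟨by simpa using hu, ?_⟩, ?_⟩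
      · rw [mem_closedBall_zero_iff, norm_div, norm_mul, Complex.norm_real,
          Real.norm_of_nonneg hc.le]
        exact div_le_one_of_le₀ hvu (by positivity)
      · simp only
        field_simp
        ring
    · rintro ⟨⟨u, ζ⟩, ⟨hu, hζ⟩, rfl⟩
      simp only [mem_closedBall_zero_iff] at hu hζ
      refine ⟨u, hu, ?_, ?_⟩
      · rintro rfl
        simp only [Set.mem_ofPred_eq, sub_self, mul_zero, add_zero, norm_zero] at hv
        linarith
      · rw [add_sub_cancel_left, norm_mul, norm_mul, Complex.norm_real, Real.norm_of_nonneg hc.le]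
        have : c * ‖ζ‖ ≤ c := mul_le_of_le_one_right hc.le hζ
        gcongr
  rw [this]
  exact hWc.inter_right (isClosed_le continuous_const (by fun_prop))

/-- Makes the local `O` global: near `1` it is the hypothesis, and away from `1` the remainder is
bounded by compactness while `‖1 - v‖` is bounded below. -/
theorem exists_logRemainder_bound {m M φ θ K : ℝ} (hm : 0 < m) (hmM : m < M) (hφ₀ : 0 < φ)
    (hφ₁ : φ < Real.pi / 2) {P : ℂ → ℂ} (hP_hol : DifferentiableOn ℂ P (deltaDomain m M φ))
    (hP_sing : (fun z : ℂ => P z - ((θ : ℂ) * Complex.log (1 / (1 - z / (m : ℂ))) + (K : ℂ)))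
      =O[𝓝[deltaDomain m M φ] (m : ℂ)] fun z : ℂ => ‖z - (m : ℂ)‖) :
    ∃ c C : ℝ, 0 < c ∧ c ≤ 1 / 2 ∧ 0 ≤ C ∧ ∀ v ∈ coneDomain c,
      1 - v ∈ Complex.slitPlane ∧
      DifferentiableAt ℂ (fun v => P (m * v) + θ * Complex.log (1 - v) - K) v ∧
      ‖P (m * v) + θ * Complex.log (1 - v) - K‖ ≤ C * ‖1 - v‖ := by
  have hcos : 0 < Real.cos φ := Real.cos_pos_of_mem_Ioo ⟨by linarith, hφ₁⟩
  have hφπ : φ ≤ Real.pi := by linarith [Real.pi_pos]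
  obtain ⟨c, hc₀, hc₁, hcφ, hcM⟩ : ∃ c : ℝ, 0 < c ∧ c ≤ 1 / 2 ∧ c < Real.cos φ * (1 - c) ∧
      m * (1 + 2 * c) < M := by
    -- The first entry gives `c ≤ 1/4`, hence `c < cos φ (1 - c)`; the second gives `m (1 + 2c) ≤ (m
    -- + M)/2`.
    refine ⟨min (Real.cos φ / 4) ((M - m) / (4 * m)), ?_, ?_, ?_, ?_⟩
    · exact lt_min (by positivity) (div_pos (by linarith) (by positivity))
    · have := min_le_left (Real.cos φ / 4) ((M - m) / (4 * m))
      linarith [Real.cos_le_one φ]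
    · have := min_le_left (Real.cos φ / 4) ((M - m) / (4 * m))
      nlinarith [Real.cos_le_one φ]
    · have := min_le_right (Real.cos φ / 4) ((M - m) / (4 * m))
      rw [le_div_iff₀ (by positivity)] at this
      nlinarith
  have hmem : ∀ v ∈ coneDomain c, (m : ℂ) * v ∈ deltaDomain m M φ := by
    rintro v ⟨u, hu, hu1, hv⟩
    exact mul_mem_deltaDomain hm hφ₀.le hφπ hcos.le hc₀.le (by linarith) hcφ hcM hu hu1 hv
  have hslit : ∀ v ∈ coneDomain c, 1 - v ∈ Complex.slitPlane := fun v hv =>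
    one_sub_mem_slitPlane_of_mem_deltaDomain hm hφ₀.le hφπ (hmem v hv)
  set r : ℂ → ℂ := fun v => P (m * v) + θ * Complex.log (1 - v) - K with hr
  have hdiff : ∀ v ∈ coneDomain c, DifferentiableAt ℂ r v := by
    intro v hv
    have h1 : DifferentiableAt ℂ P (m * v) :=
      hP_hol.differentiableAt ((isOpen_deltaDomain hφ₀.le hφπ).mem_nhds (hmem v hv))
    have h2 : DifferentiableAt ℂ (fun v : ℂ => P (m * v)) v :=
      h1.comp v (f := fun v : ℂ => (m : ℂ) * v) (by fun_prop)
    have h3 : DifferentiableAt ℂ (fun v : ℂ => Complex.log (1 - v)) v :=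
      DifferentiableAt.clog (by fun_prop) (hslit v hv)
    exact (h2.add (h3.const_mul _)).sub_const _
  obtain ⟨C₁, hC₁, hb⟩ := hP_sing.exists_nonneg
  have hb := hb.bound
  rw [eventually_nhdsWithin_iff, Metric.eventually_nhds_iff] at hb
  obtain ⟨ε, hε, hb⟩ := hb
  have hεm : 0 < ε / m := by positivity
  have hKc := isCompact_coneDomain_diff_ball hc₀ hεm
  obtain ⟨C₂, hC₂⟩ := hKc.exists_bound_of_continuousOn (f := r)
    fun v hv => (hdiff v hv.1).continuousAt.continuousWithinAt
  refine ⟨c, C₁ * m + |C₂| / (ε / m), hc₀, hc₁, by positivity,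
    fun v hv => ⟨hslit v hv, hdiff v hv, ?_⟩⟩
  rw [norm_sub_rev 1 v, add_mul]
  rcases lt_or_ge ‖v - 1‖ (ε / m) with h | h
  · have hnorm : ‖(m : ℂ) * v - m‖ = m * ‖v - 1‖ := by
      rw [show (m : ℂ) * v - m = m * (v - 1) by ring, norm_mul, Complex.norm_real,
        Real.norm_of_nonneg hm.le]
    have h1 := hb (y := (m : ℂ) * v) (by
      rw [dist_eq_norm, hnorm]; rwa [lt_div_iff₀' hm] at h) (hmem v hv)
    have hmne : (m : ℂ) ≠ 0 := by exact_mod_cast hm.ne'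
    rw [norm_norm, hnorm, mul_div_cancel_left₀ _ hmne, one_div,
      Complex.log_inv _ (Complex.mem_slitPlane_iff_arg.1 (hslit v hv)).1] at h1
    have h2 : r v = P (m * v) - ((θ : ℂ) * -Complex.log (1 - v) + K) := by rw [hr]; ring
    change ‖r v‖ ≤ _
    rw [h2]
    refine h1.trans ?_
    rw [← mul_assoc]
    exact le_add_of_nonneg_right (by positivity)
  · change ‖r v‖ ≤ _
    refine (hC₂ v ⟨hv, h⟩).trans ((le_abs_self _).trans ?_)
    have h1 : |C₂| ≤ |C₂| / (ε / m) * ‖v - 1‖ := by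
      rw [div_mul_eq_mul_div, le_div_iff₀ hεm]
      gcongr
    exact h1.trans (le_add_of_nonneg_left (by positivity))

/-! ### Transfer: from growth at the singularity to Taylor coefficients. -/

theorem norm_one_sub_circleMap_sq (r t : ℝ) :
    ‖1 - circleMap 0 r t‖ ^ 2 = ‖circleMap 0 1 t - r‖ ^ 2 := by
  rw [Complex.sq_norm, Complex.sq_norm, Complex.normSq_apply, Complex.normSq_apply]
  simp only [circleMap, zero_add, Complex.sub_re, Complex.one_re, Complex.re_ofReal_mul,
    Complex.exp_ofReal_mul_I_re, Complex.sub_im, Complex.one_im, Complex.im_ofReal_mul,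
    Complex.exp_ofReal_mul_I_im, Complex.ofReal_re, Complex.ofReal_im, zero_sub, sub_zero]
  linear_combination (r ^ 2 - 1) * Real.sin_sq_add_cos_sq t

/-- The Poisson kernel at the point `r` has mean one on the unit circle, and `|1 - r e^{it}| =
|e^{it} - r|`. -/
theorem average_inv_norm_one_sub_circleMap_sq {r : ℝ} (hr₀ : 0 ≤ r) (hr₁ : r < 1) :
    (2 * Real.pi)⁻¹ * ∫ t in 0..2 * Real.pi, (‖1 - circleMap 0 r t‖ ^ 2)⁻¹ = (1 - r ^ 2)⁻¹ := by
  have h := DiffContOnCl.circleAverage_poissonKernel_smul' (f := fun _ : ℂ => (1 : ℂ)) (c := 0)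
    (R := 1) (w := (r : ℂ)) diffContOnCl_const (by simpa [abs_of_nonneg hr₀] using hr₁)
  rw [Real.circleAverage_def] at h
  have h1 : ∀ t : ℝ, ((‖circleMap 0 1 t - 0‖ ^ 2 - ‖(r : ℂ) - 0‖ ^ 2)
      / ‖circleMap 0 1 t - 0 - ((r : ℂ) - 0)‖ ^ 2) • (1 : ℂ)
      = (((1 - r ^ 2) * (‖1 - circleMap 0 r t‖ ^ 2)⁻¹ : ℝ) : ℂ) := by
    intro t
    rw [norm_one_sub_circleMap_sq, sub_zero, sub_zero, norm_circleMap_zero, Complex.norm_real,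
      Real.norm_of_nonneg hr₀]
    simp [div_eq_mul_inv]
  simp_rw [h1] at h
  rw [intervalIntegral.integral_ofReal, intervalIntegral.integral_const_mul,
    Complex.real_smul] at h
  have h2 : (1 - r ^ 2) ≠ 0 := by nlinarith
  have h3 : (2 * Real.pi)⁻¹ *
      ((1 - r ^ 2) * ∫ t in 0..2 * Real.pi, (‖1 - circleMap 0 r t‖ ^ 2)⁻¹) = 1 := by
    exact_mod_cast h
  refine eq_inv_of_mul_eq_one_left ?_
  linear_combination h3

open scoped Nat in
theorem norm_iteratedDeriv_le_of_circle {F : ℂ → ℂ} (hF : DifferentiableOn ℂ F (Metric.ball 0 1))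
    {r : ℝ} (hr₀ : 0 < r) (hr₁ : r < 1) {D : ℝ}
    (hb : ∀ u, ‖u‖ = r → ‖F u‖ ≤ D * (‖1 - u‖ ^ 2)⁻¹) (j : ℕ) :
    ‖iteratedDeriv j F 0‖ ≤ j ! * (D * (1 - r ^ 2)⁻¹ * r⁻¹ ^ j) := by
  lift r to NNReal using hr₀.le
  have hsub : Metric.closedBall (0 : ℂ) r ⊆ Metric.ball 0 1 :=
    Metric.closedBall_subset_ball hr₁
  have hps := (hF.mono hsub).hasFPowerSeriesOnBall (by exact_mod_cast hr₀)
  have h := hps.factorial_smul 1 j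
  rw [iteratedFDeriv_apply_eq_iteratedDeriv_mul_prod, Finset.prod_const_one, one_smul] at h
  rw [← h, nsmul_eq_mul, norm_mul, Complex.norm_natCast]
  gcongr
  have h1 : ‖cauchyPowerSeries F 0 r j fun _ => 1‖ ≤ ‖cauchyPowerSeries F 0 r j‖ := by
    simp
  refine h1.trans ((norm_cauchyPowerSeries_le F 0 r j).trans ?_)
  rw [abs_of_nonneg hr₀.le, ← average_inv_norm_one_sub_circleMap_sq hr₀.le hr₁, mul_left_comm D,
    ← intervalIntegral.integral_const_mul D]
  have hne : ∀ t : ℝ, ‖1 - circleMap 0 r t‖ ^ 2 ≠ 0 := fun t => by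
    refine pow_ne_zero _ (norm_ne_zero_iff.2 (sub_ne_zero.2 fun h => ?_))
    have := congrArg norm h
    rw [norm_one, norm_circleMap_zero, abs_of_nonneg hr₀.le] at this
    exact hr₁.ne this.symm
  refine mul_le_mul_of_nonneg_right (mul_le_mul_of_nonneg_left ?_ (by positivity)) (by positivity)
  refine intervalIntegral.integral_mono_on (by positivity) ?_ ?_ fun t _ => ?_
  · refine Continuous.intervalIntegrable ?_ _ _
    refine Continuous.norm (hF.continuousOn.comp_continuous (continuous_circleMap 0 r) fun t => ?_)
    rw [mem_ball_zero_iff, norm_circleMap_zero, abs_of_nonneg hr₀.le]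
    exact hr₁
  · refine Continuous.intervalIntegrable ?_ _ _
    exact continuous_const.mul ((((continuous_const.sub (continuous_circleMap 0 r)).norm).pow 2).inv₀
      hne)
  · exact hb _ (by rw [norm_circleMap_zero, abs_of_nonneg hr₀.le])

-- Two of the `s` powers are averaged exactly over the circle and cost only `n+1`; the other `s - 2`
-- are bounded pointwise by `(n+1)^{s-2}`.
open scoped Nat in
theorem norm_iteratedDeriv_le_of_norm_le_rpow {F : ℂ → ℂ}
    (hF : DifferentiableOn ℂ F (Metric.ball 0 1)) {D s : ℝ} (hD : 0 ≤ D) (hs : 2 ≤ s)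
    (hb : ∀ u, ‖u‖ < 1 → ‖F u‖ ≤ D * ‖1 - u‖ ^ (-s)) {n j : ℕ} (hn : 1 ≤ n) (hj : j ≤ n) :
    ‖iteratedDeriv j F 0‖ ≤ j ! * (D * Real.exp 1 * ((n : ℝ) + 1) ^ (s - 1)) := by
  have hn0 : (0 : ℝ) < n := by exact_mod_cast hn
  -- With this radius `1 - r = 1/(n+1)`, while `r⁻¹ ^ j ≤ (1 + 1/n)^n ≤ e`.
  set r : ℝ := n / (n + 1) with hr
  have hr₀ : 0 < r := by positivity
  have hr₁ : r < 1 := (div_lt_one (by positivity)).2 (by linarith)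
  have h1r : 1 - r = ((n : ℝ) + 1)⁻¹ := by rw [hr]; field_simp; ring
  refine (norm_iteratedDeriv_le_of_circle hF hr₀ hr₁ (D := D * ((n : ℝ) + 1) ^ (s - 2))
    (fun u hu => ?_) j).trans ?_
  · refine (hb u (hu ▸ hr₁)).trans ?_
    have hd : 1 - r ≤ ‖1 - u‖ := by
      have := norm_sub_norm_le 1 u
      rwa [norm_one, hu] at this
    have hd0 : 0 < 1 - r := by linarith
    rw [mul_assoc]
    gcongr
    have h2 : ‖1 - u‖ ^ (-s) = ‖1 - u‖ ^ (-(s - 2)) * (‖1 - u‖ ^ 2)⁻¹ := by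
      rw [← Real.rpow_natCast, ← Real.rpow_neg (norm_nonneg _),
        ← Real.rpow_add (hd0.trans_le hd)]
      congr 1
      push_cast
      ring
    rw [h2]
    gcongr
    calc ‖1 - u‖ ^ (-(s - 2)) ≤ (1 - r) ^ (-(s - 2)) :=
          Real.rpow_le_rpow_of_nonpos hd0 hd (by linarith)
      _ = _ := by rw [h1r, Real.inv_rpow (by positivity), Real.rpow_neg (by positivity), inv_inv]
  · refine mul_le_mul_of_nonneg_left ?_ (by positivity)
    have h3 : (1 - r ^ 2)⁻¹ ≤ (n : ℝ) + 1 := by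
      rw [inv_le_comm₀ (by nlinarith) (by positivity), ← h1r]
      nlinarith
    have h4 : r⁻¹ ^ j ≤ Real.exp 1 := by
      have h5 : r⁻¹ = 1 + 1 / n := by rw [hr]; field_simp
      have h6 : (1 : ℝ) ≤ r⁻¹ := by
        rw [h5]; linarith [show 0 < 1 / (n : ℝ) by positivity]
      calc r⁻¹ ^ j ≤ r⁻¹ ^ n := pow_le_pow_right₀ h6 hj
        _ ≤ Real.exp (1 / n) ^ n := by
          refine pow_le_pow_left₀ (by positivity) ?_ n
          rw [h5, add_comm]
          exact Real.add_one_le_exp _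
        _ = Real.exp 1 := by
          rw [← Real.exp_nat_mul]
          congr 1
          field_simp
    have h7 : ((n : ℝ) + 1) ^ (s - 1) = ((n : ℝ) + 1) ^ (s - 2) * ((n : ℝ) + 1) := by
      conv_rhs => rw [← Real.rpow_add_one (by positivity)]
      congr 1
      ring
    calc D * ((n : ℝ) + 1) ^ (s - 2) * (1 - r ^ 2)⁻¹ * r⁻¹ ^ j
        ≤ D * ((n : ℝ) + 1) ^ (s - 2) * ((n : ℝ) + 1) * Real.exp 1 := by gcongr
      _ = _ := by rw [h7]; ring

theorem rpow_le_two_rpow_mul {x y β b : ℝ} (hx : 0 < x) (hxy : x / 2 ≤ y) (hyx : y ≤ 2 * x)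
    (hβ : |β| ≤ b) : y ^ β ≤ 2 ^ b * x ^ β := by
  have hy : 0 < y := by linarith
  have hb := abs_le.1 hβ
  rcases le_total 0 β with h | h
  · calc y ^ β ≤ (2 * x) ^ β := Real.rpow_le_rpow hy.le hyx h
      _ = 2 ^ β * x ^ β := Real.mul_rpow (by norm_num) hx.le
      _ ≤ _ := by
        gcongr
        · norm_num
        · exact hb.2
  · calc y ^ β ≤ (x / 2) ^ β := Real.rpow_le_rpow_of_nonpos (by linarith) hxy h
      _ = 2 ^ (-β) * x ^ β := by
        rw [Real.div_rpow hx.le (by norm_num), Real.rpow_neg (by norm_num)]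
        ring
      _ ≤ _ := by
        gcongr
        · norm_num
        · linarith

-- Cauchy's estimate on the disc of radius `c ‖1-u‖` about `u`: it lies in the cone domain, and as
-- `c ≤ 1/2`, `‖1-v‖` stays within a factor `2` of `‖1-u‖` on it.
open scoped Nat in
theorem norm_iteratedDeriv_le_of_coneDomain {f : ℂ → ℂ} {c D β b : ℝ} (hc₀ : 0 < c)
    (hc₁ : c ≤ 1 / 2) (hβ : |β| ≤ b) (hD : 0 ≤ D)
    (hf : ∀ v ∈ coneDomain c, DifferentiableAt ℂ f v ∧ ‖f v‖ ≤ D * ‖1 - v‖ ^ β) (k : ℕ) {u : ℂ}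
    (hu : ‖u‖ < 1) :
    ‖iteratedDeriv k f u‖ ≤ k ! * (D * 2 ^ b) / c ^ k * ‖1 - u‖ ^ (-(k - β)) := by
  have hu1 : u ≠ 1 := by rintro rfl; simp at hu
  have hd : 0 < ‖1 - u‖ := norm_pos_iff.2 (sub_ne_zero.2 hu1.symm)
  have hR : 0 < c * ‖1 - u‖ := by positivity
  have hsub : Metric.closedBall u (c * ‖1 - u‖) ⊆ coneDomain c := fun v hv =>
    ⟨u, hu.le, hu1, by simpa [dist_eq_norm] using hv⟩
  have hdiff : DiffContOnCl ℂ f (Metric.ball u (c * ‖1 - u‖)) := by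
    refine DifferentiableOn.diffContOnCl fun v hv => ?_
    exact (hf v (hsub (Metric.closure_ball_subset_closedBall hv))).1.differentiableWithinAt
  refine (Complex.norm_iteratedDeriv_le_of_forall_mem_sphere_norm_le k hR hdiff
    (C := D * (2 ^ b * ‖1 - u‖ ^ β)) fun v hv => ?_).trans (le_of_eq ?_)
  · refine (hf v (hsub (Metric.sphere_subset_closedBall hv))).2.trans ?_
    have hv : ‖v - u‖ = c * ‖1 - u‖ := by simpa [dist_eq_norm] using hv
    gcongr
    refine rpow_le_two_rpow_mul hd ?_ ?_ hβ
    · have : ‖1 - u‖ ≤ ‖1 - v‖ + ‖v - u‖ := by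
        simpa using norm_add_le (1 - v) (v - u)
      nlinarith
    · have : ‖1 - v‖ ≤ ‖1 - u‖ + ‖v - u‖ := by
        simpa using norm_sub_le (1 - u) (v - u)
      nlinarith
  · rw [neg_sub, Real.rpow_sub hd, Real.rpow_natCast, mul_pow]
    field_simp

-- The constants depend only on `b` and `c`, not on `f`; this is what makes the later estimates
-- uniform in `w`. The coefficient is read off as the `(n-k)`-th derivative of the `k`-th
-- derivative, whose growth exponent is at least `2`.
open scoped Nat in
theorem exists_norm_taylorCoeff_le {c b : ℝ} (hc₀ : 0 < c) (hc₁ : c ≤ 1 / 2) :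
    ∃ (N : ℕ) (A : ℝ), 1 ≤ N ∧ 0 ≤ A ∧ ∀ (f : ℂ → ℂ) (D β : ℝ), |β| ≤ b → 0 ≤ D →
      (∀ v ∈ coneDomain c, DifferentiableAt ℂ f v ∧ ‖f v‖ ≤ D * ‖1 - v‖ ^ β) →
      ∀ n : ℕ, N ≤ n → ‖iteratedDeriv n f 0 / (n ! : ℂ)‖ ≤ A * D * (n : ℝ) ^ (-β - 1) := by
  -- Ensures `k - β ≥ 2` for every admissible `β`.
  obtain ⟨k, hk⟩ := exists_nat_ge (b + 2)
  refine ⟨k + 1, (k + 1) ^ k * (k ! * 2 ^ b / c ^ k * Real.exp 1 * 2 ^ (k + b)), by omega,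
    by positivity, fun f D β hβ hD hf n hn => ?_⟩
  have hβ' := abs_le.1 hβ
  obtain ⟨j, rfl⟩ : ∃ j, n = j + k := ⟨n - k, by omega⟩
  set n := j + k with hn_def
  have hn0 : (0 : ℝ) < n := by exact_mod_cast (by omega : 0 < n)
  set E := k ! * (D * 2 ^ b) / c ^ k with hE
  have hE0 : 0 ≤ E := by positivity
  have hball : ∀ u ∈ Metric.ball (0 : ℂ) 1, u ∈ coneDomain c := fun u hu => by
    refine ⟨u, (mem_ball_zero_iff.1 hu).le, ?_, by simp; positivity⟩
    rintro rfl; simp at hu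
  have hfk : DifferentiableOn ℂ (iteratedDeriv k f) (Metric.ball 0 1) := by
    have h1 : DifferentiableOn ℂ f (Metric.ball 0 1) := fun u hu =>
      (hf u (hball u hu)).1.differentiableWithinAt
    have h2 : AnalyticOnNhd ℂ f (Metric.ball 0 1) := h1.analyticOnNhd Metric.isOpen_ball
    rw [iteratedDeriv_eq_iterate]
    exact (h2.iterated_deriv k).differentiableOn
  have h := norm_iteratedDeriv_le_of_norm_le_rpow hfk hE0 (s := k - β) (by linarith)
    (fun u hu => norm_iteratedDeriv_le_of_coneDomain hc₀ hc₁ hβ hD hf k hu)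
    (n := n) (j := j) (by omega) (by omega)
  have hiter : iteratedDeriv j (iteratedDeriv k f) = iteratedDeriv n f := by
    rw [iteratedDeriv_eq_iterate, iteratedDeriv_eq_iterate, iteratedDeriv_eq_iterate,
      ← Function.iterate_add_apply]
  rw [hiter] at h
  -- The `k` derivatives cost `n^k` in growth; passing from `j!` to `n!` recovers it up to a
  -- constant.
  have hfac : (j ! : ℝ) * (n : ℝ) ^ k ≤ (k + 1) ^ k * n ! := by
    have h1 : j ! * (j + 1) ^ k ≤ n ! := Nat.factorial_mul_pow_le_factorial
    have h2 : n ≤ (k + 1) * (j + 1) := by rw [hn_def]; nlinarith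
    have h3 : j ! * n ^ k ≤ (k + 1) ^ k * n ! := by
      calc j ! * n ^ k ≤ j ! * ((k + 1) * (j + 1)) ^ k := by gcongr
        _ = (k + 1) ^ k * (j ! * (j + 1) ^ k) := by rw [mul_pow]; ring
        _ ≤ _ := by gcongr
    exact_mod_cast h3
  have hpow : ((n : ℝ) + 1) ^ ((k : ℝ) - β - 1) ≤ 2 ^ (k + b) * (n : ℝ) ^ ((k : ℝ) - β - 1) := by
    have hn1 : (1 : ℝ) ≤ n := by exact_mod_cast (by omega : 1 ≤ n)
    refine rpow_le_two_rpow_mul hn0 (by linarith) (by linarith) ?_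
    rw [abs_le]; constructor <;> linarith
  have hsplit : (n : ℝ) ^ ((k : ℝ) - β - 1) = (n : ℝ) ^ k * (n : ℝ) ^ (-β - 1) := by
    rw [← Real.rpow_natCast, ← Real.rpow_add hn0]
    congr 1; ring
  rw [norm_div, Complex.norm_natCast, div_le_iff₀ (by positivity)]
  calc _ ≤ (j ! : ℝ) * (E * Real.exp 1 * (2 ^ (k + b) * ((n : ℝ) ^ k * (n : ℝ) ^ (-β - 1)))) := by
        refine h.trans ?_
        rw [← hsplit]
        gcongr
    _ = (j ! * (n : ℝ) ^ k) * (E * Real.exp 1 * (2 ^ (k + b) * (n : ℝ) ^ (-β - 1))) := by ring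
    _ ≤ ((k + 1) ^ k * n !) * (E * Real.exp 1 * (2 ^ (k + b) * (n : ℝ) ^ (-β - 1))) := by
        gcongr
    _ = _ := by rw [hE]; ring

/-! ### Coefficients of `exp (w P)`, uniformly for bounded `w`. -/

theorem norm_exp_mul_log_le (α : ℂ) {x : ℂ} (hx : x ≠ 0) :
    ‖Complex.exp (-α * Complex.log x)‖ ≤ ‖x‖ ^ (-α.re) * Real.exp (Real.pi * ‖α‖) := by
  rw [Complex.norm_exp, Real.rpow_def_of_pos (norm_pos_iff.2 hx), ← Real.exp_add, Complex.mul_re,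
    Complex.log_re, Complex.log_im, Complex.neg_re, Complex.neg_im]
  refine Real.exp_le_exp.2 ?_
  have h : α.im * x.arg ≤ Real.pi * ‖α‖ := by
    calc α.im * x.arg ≤ |α.im| * |x.arg| := by rw [← abs_mul]; exact le_abs_self _
      _ ≤ ‖α‖ * Real.pi :=
        mul_le_mul (Complex.abs_im_le_norm α) (Complex.abs_arg_le_pi x) (abs_nonneg _)
          (norm_nonneg _)
      _ = _ := mul_comm _ _
  linarith

theorem norm_one_sub_le_three_of_mem_coneDomain {c : ℝ} (hc₀ : 0 ≤ c) (hc₁ : c ≤ 1 / 2) {v : ℂ}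
    (hv : v ∈ coneDomain c) : ‖1 - v‖ ≤ 3 := by
  obtain ⟨u, hu, -, hvu⟩ := hv
  have h1 : ‖1 - u‖ ≤ 2 := by
    have := norm_sub_le 1 u
    rw [norm_one] at this
    linarith
  have h2 : ‖1 - v‖ ≤ ‖1 - u‖ + ‖v - u‖ := by
    simpa using norm_sub_le (1 - u) (v - u)
  nlinarith [norm_nonneg (1 - u)]

/-- The factor `e^{w r} - 1` is `O(‖1-v‖)`, so the correction gains one power over `(1-v)^{-wθ}`. -/
theorem exists_norm_exp_mul_log_mul_exp_sub_one_le {c C θ B : ℝ} (hc₀ : 0 < c) (hc₁ : c ≤ 1 / 2)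
    (hC : 0 ≤ C) (hθ : 0 < θ) (hB : 0 ≤ B) {r : ℂ → ℂ}
    (hr : ∀ v ∈ coneDomain c,
      1 - v ∈ Complex.slitPlane ∧ DifferentiableAt ℂ r v ∧ ‖r v‖ ≤ C * ‖1 - v‖) :
    ∃ D, 0 ≤ D ∧ ∀ w : ℂ, ‖w‖ ≤ B → ∀ v ∈ coneDomain c,
      DifferentiableAt ℂ (fun u => Complex.exp (-(w * θ) * Complex.log (1 - u))
        * (Complex.exp (w * r u) - 1)) v ∧
      ‖Complex.exp (-(w * θ) * Complex.log (1 - v)) * (Complex.exp (w * r v) - 1)‖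
        ≤ D * ‖1 - v‖ ^ (1 - w.re * θ) := by
  refine ⟨Real.exp (Real.pi * (B * θ)) * (B * C * Real.exp (B * (C * 3))), by positivity,
    fun w hw v hv => ?_⟩
  obtain ⟨hs, hd, hb⟩ := hr v hv
  refine ⟨?_, ?_⟩
  · have h3 : DifferentiableAt ℂ (fun v : ℂ => Complex.log (1 - v)) v :=
      DifferentiableAt.clog (by fun_prop) hs
    exact (h3.const_mul _).cexp.mul ((hd.const_mul w).cexp.sub_const 1)
  · have hne : 1 - v ≠ 0 := Complex.slitPlane_ne_zero hs
    have hpos : 0 < ‖1 - v‖ := norm_pos_iff.2 hne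
    have h3 := norm_one_sub_le_three_of_mem_coneDomain hc₀.le hc₁ hv
    have h1 : ‖Complex.exp (-(w * θ) * Complex.log (1 - v))‖
        ≤ ‖1 - v‖ ^ (-(w.re * θ)) * Real.exp (Real.pi * (B * θ)) := by
      refine (norm_exp_mul_log_le _ hne).trans ?_
      rw [Complex.re_mul_ofReal, norm_mul, Complex.norm_real, Real.norm_of_nonneg hθ.le]
      gcongr
    have h2 : ‖w * r v‖ ≤ B * (C * ‖1 - v‖) := by
      rw [norm_mul]
      exact mul_le_mul hw hb (norm_nonneg _) hB
    have h4 : ‖Complex.exp (w * r v) - 1‖ ≤ B * (C * ‖1 - v‖) * Real.exp (B * (C * 3)) := by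
      refine (norm_exp_sub_one_le_mul_exp _).trans ?_
      gcongr
      exact h2.trans (by gcongr)
    rw [norm_mul]
    calc _ ≤ (‖1 - v‖ ^ (-(w.re * θ)) * Real.exp (Real.pi * (B * θ)))
          * (B * (C * ‖1 - v‖) * Real.exp (B * (C * 3))) :=
          mul_le_mul h1 h4 (norm_nonneg _) (by positivity)
      _ = _ := by
          rw [show 1 - w.re * θ = -(w.re * θ) + 1 by ring, Real.rpow_add_one hpos.ne']
          ring

theorem exists_norm_partitionSum_sub_le {Θ : ℕ → ℝ} {m M φ θ K : ℝ} (hm : 0 < m) (hmM : m < M)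
    (hφ₀ : 0 < φ) (hφ₁ : φ < Real.pi / 2) (hθ : 0 < θ) {P : ℂ → ℂ}
    (hP_series : ∀ᶠ z in 𝓝 (0 : ℂ),
      HasSum (fun j : ℕ => ((Θ (j + 1) / ((j + 1 : ℕ) : ℝ) : ℝ) : ℂ) * z ^ (j + 1)) (P z))
    (hP_hol : DifferentiableOn ℂ P (deltaDomain m M φ))
    (hP_sing : (fun z : ℂ => P z - ((θ : ℂ) * Complex.log (1 / (1 - z / (m : ℂ))) + (K : ℂ)))
      =O[𝓝[deltaDomain m M φ] (m : ℂ)] fun z : ℂ => ‖z - (m : ℂ)‖) {B : ℝ} (hB : 0 ≤ B) :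
    ∃ (N : ℕ) (A : ℝ), 1 ≤ N ∧ 0 ≤ A ∧ ∀ n : ℕ, N ≤ n → ∀ w : ℂ, ‖w‖ ≤ B →
      ‖partitionSum (fun k => w * Θ k) n * (m : ℂ) ^ n * Complex.exp (-(w * K))
        - (∏ k ∈ Finset.range n, (w * θ + k)) / (n.factorial : ℂ)‖ ≤ A * (n : ℝ) ^ (w.re * θ - 2) := by
  obtain ⟨c, C, hc₀, hc₁, hC, hr⟩ := exists_logRemainder_bound hm hmM hφ₀ hφ₁ hP_hol hP_sing
  set r : ℂ → ℂ := fun v => P (m * v) + θ * Complex.log (1 - v) - K with hr_def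
  obtain ⟨D, hD, hG⟩ := exists_norm_exp_mul_log_mul_exp_sub_one_le hc₀ hc₁ hC hθ hB hr
  obtain ⟨N, A, hN, hA, hcoef⟩ := exists_norm_taylorCoeff_le (b := 1 + B * θ) hc₀ hc₁
  refine ⟨N, A * D, hN, by positivity, fun n hn w hw => ?_⟩
  set G : ℂ → ℂ := fun u => Complex.exp (-(w * θ) * Complex.log (1 - u))
        * (Complex.exp (w * r u) - 1) with hG_def
  have hβ : |1 - w.re * θ| ≤ 1 + B * θ := by
    have h1 : |w.re * θ| ≤ B * θ := by
      rw [abs_mul, abs_of_pos hθ]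
      have := (Complex.abs_re_le_norm w).trans hw
      gcongr
    have := abs_sub 1 (w.re * θ)
    rw [abs_one] at this
    linarith
  have hmain := hcoef G D (1 - w.re * θ) hβ hD (hG w hw) n hn
  rw [show -(1 - w.re * θ) - 1 = w.re * θ - 2 by ring] at hmain
  refine le_trans (le_of_eq ?_) hmain
  congr 1
  have hfac : (n.factorial : ℂ) ≠ 0 := by exact_mod_cast n.factorial_ne_zero
  have hQ : ∀ᶠ u in 𝓝 (0 : ℂ), HasSum
      (fun j : ℕ => (w * Θ (j + 1) * (m : ℂ) ^ (j + 1)) / ((j + 1 : ℕ) : ℂ) * u ^ (j + 1))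
      (w * P (m * u)) := by
    have ht : Tendsto (fun u : ℂ => (m : ℂ) * u) (𝓝 0) (𝓝 0) := by
      have : Continuous fun u : ℂ => (m : ℂ) * u := by fun_prop
      simpa using this.tendsto 0
    filter_upwards [ht.eventually hP_series] with u hu
    refine (hu.mul_left w).congr_fun ?_
    intro j
    push_cast
    ring
  have hT := iteratedDeriv_exp_comp_eq_partitionSum (y := fun k => w * Θ k * (m : ℂ) ^ k) hQ n
  rw [partitionSum_smul_pow] at hT
  -- Valid for all `u`, by pure algebra in the exponent: the logarithm in `r` cancels the one put in
  -- by hand.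
  have hdecomp : (fun u => Complex.exp (w * P (m * u))) = fun u => Complex.exp (w * K)
      * (Complex.exp (-(w * θ) * Complex.log (1 - u)) + G u) := by
    funext u
    rw [hG_def]
    simp only
    rw [mul_sub, mul_one, add_sub_cancel, ← Complex.exp_add, ← Complex.exp_add, hr_def]
    congr 1
    ring
  have h0 : (0 : ℂ) ∈ Metric.ball (0 : ℂ) 1 := Metric.mem_ball_self one_pos
  have hGan : AnalyticAt ℂ G 0 := by
    have h1 : DifferentiableOn ℂ G (Metric.ball 0 1) := fun u hu => by
      refine (hG w hw u ⟨u, (mem_ball_zero_iff.1 hu).le, ?_, ?_⟩).1.differentiableWithinAt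
      · rintro rfl; simp at hu
      · rw [sub_self, norm_zero]; positivity
    exact h1.analyticAt (Metric.isOpen_ball.mem_nhds h0)
  have hpow : AnalyticAt ℂ (fun u : ℂ => Complex.exp (-(w * θ) * Complex.log (1 - u))) 0 := by
    have h1 : DifferentiableOn ℂ
        (fun u : ℂ => Complex.exp (-(w * θ) * Complex.log (1 - u))) (Metric.ball 0 1) :=
      fun u hu => (hasDerivAt_exp_mul_log_one_sub (w * θ) (one_sub_mem_slitPlane_of_norm_lt_one
        (mem_ball_zero_iff.1 hu))).differentiableAt.differentiableWithinAt
    exact h1.analyticAt (Metric.isOpen_ball.mem_nhds h0)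
  rw [hdecomp, iteratedDeriv_const_mul_field, iteratedDeriv_fun_add hpow.contDiffAt
    hGan.contDiffAt, iteratedDeriv_exp_mul_log_one_sub _ n h0] at hT
  simp only [sub_zero, Complex.log_one, mul_zero, Complex.exp_zero, mul_one] at hT
  have hK : Complex.exp (-(w * K)) * Complex.exp (w * K) = 1 := by
    rw [← Complex.exp_add, neg_add_cancel, Complex.exp_zero]
  rw [eq_div_iff hfac, sub_mul, div_mul_cancel₀ _ hfac]
  linear_combination (-Complex.exp (-(w * K))) * hT
    + (∏ k ∈ Finset.range n, (w * θ + k) + iteratedDeriv n G 0) * hK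

/-! ### Lower bound for the denominator and passage to the limit. -/

-- Euler's sequence `n^θ n! / ∏_{k≤n} (θ+k)` converges to `Γ(θ)`, hence is bounded above.
open scoped Nat in
theorem exists_mul_rpow_le_prod_div_factorial {θ : ℝ} (hθ : 0 < θ) :
    ∃ κ, 0 < κ ∧ ∀ n : ℕ, 1 ≤ n →
      κ * (n : ℝ) ^ (θ - 1) ≤ (∏ k ∈ Finset.range n, (θ + k)) / n ! := by
  obtain ⟨G, hG⟩ := (Real.GammaSeq_tendsto_Gamma θ).bddAbove_range
  have hG' : ∀ n, Real.GammaSeq θ n ≤ G := fun n => hG ⟨n, rfl⟩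
  have hprod : ∀ n, 0 < ∏ k ∈ Finset.range n, (θ + (k : ℝ)) := fun n =>
    Finset.prod_pos fun k _ => by positivity
  have hG0 : 0 < G := by
    refine lt_of_lt_of_le ?_ (hG' 1)
    have := hprod 2
    rw [Real.GammaSeq]
    positivity
  refine ⟨(G * (θ + 1))⁻¹, by positivity, fun n hn => ?_⟩
  have hn1 : (1 : ℝ) ≤ n := by exact_mod_cast hn
  have h := hG' n
  rw [Real.GammaSeq, Finset.prod_range_succ,
    div_le_iff₀ (mul_pos (hprod n) (by positivity))] at h
  rw [le_div_iff₀ (by positivity), mul_assoc, inv_mul_le_iff₀ (by positivity),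
    Real.rpow_sub_one (by positivity), div_mul_eq_mul_div, div_le_iff₀ (by positivity)]
  calc _ ≤ G * ((∏ k ∈ Finset.range n, (θ + (k : ℝ))) * (θ + n)) := h
    _ ≤ G * ((∏ k ∈ Finset.range n, (θ + (k : ℝ))) * ((θ + 1) * n)) := by
        have := (hprod n).le
        gcongr
        nlinarith
    _ = _ := by ring

theorem continuous_probGenFun_weightedPerm (Θ : ℕ → ℝ) (hΘ : ∀ k, 1 ≤ k → 0 < Θ k) (n : ℕ) :
    Continuous fun w => probGenFun (weightedPerm Θ hΘ n).toMeasure numCycles w := by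
  simp only [probGenFun_weightedPerm_eq_sum]
  fun_prop

theorem exists_norm_elemSeries_le {θ : ℝ} (hθ : 0 < θ) (B : ℝ) :
    ∃ C, 0 ≤ C ∧ ∀ z : ℂ, ‖z‖ ≤ B → ‖elemSeries (fun k => θ / (θ + k)) z‖ ≤ C := by
  obtain ⟨C, hC, h⟩ := exists_norm_elemPartial_le hθ B
  exact ⟨C, hC, fun z hz => le_of_tendsto (tendsto_elemPartial hθ z).norm
    (Eventually.of_forall fun n => h n z hz)⟩

theorem norm_perturbed_ratio_sub_le {X δ η L : ℂ} {a b d l : ℝ} (hX : ‖X - L‖ ≤ a)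
    (hδ : ‖δ‖ ≤ b) (hη : ‖η‖ ≤ d) (hd : d ≤ 1 / 2) (hL : ‖L‖ ≤ l) :
    ‖(X + δ) / (1 + η) - L‖ ≤ 2 * (a + b + d * l) := by
  have h1 : 1 / 2 ≤ ‖1 + η‖ := by
    have := norm_sub_norm_le 1 (-η)
    rw [norm_one, norm_neg, sub_neg_eq_add] at this
    linarith
  have hne : 1 + η ≠ 0 := norm_pos_iff.1 (by linarith)
  have h2 : (X + δ) / (1 + η) - L = ((X - L) + δ - η * L) / (1 + η) := by
    field_simp
    ring
  have h3 : ‖(X - L) + δ - η * L‖ ≤ a + b + d * l := by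
    refine (norm_sub_le _ _).trans (add_le_add ((norm_add_le _ _).trans (add_le_add hX hδ)) ?_)
    rw [norm_mul]
    exact mul_le_mul hη hL (norm_nonneg _) ((norm_nonneg _).trans hη)
  rw [h2, norm_div, div_le_iff₀ (by linarith)]
  have : 0 ≤ a + b + d * l := (norm_nonneg _).trans h3
  nlinarith

theorem norm_exp_neg_mul_log_add (θ γ : ℝ) {n : ℕ} (hn : 1 ≤ n) (w : ℂ) :
    ‖Complex.exp (-(w - 1) * ((θ * Real.log n + γ : ℝ) : ℂ))‖
      = (n : ℝ) ^ (θ - w.re * θ) * Real.exp ((1 - w.re) * γ) := by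
  have hn0 : (0 : ℝ) < n := by exact_mod_cast hn
  rw [Complex.norm_exp, Complex.re_mul_ofReal, Real.rpow_def_of_pos hn0, ← Real.exp_add]
  congr 1
  simp only [Complex.neg_re, Complex.sub_re, Complex.one_re]
  ring

theorem exists_norm_probGenFun_sub_elemSeries_le_of_le {Θ : ℕ → ℝ} (hΘ : ∀ k, 1 ≤ k → 0 < Θ k)
    {m M φ θ K : ℝ} (hm : 0 < m) (hmM : m < M)
    (hφ₀ : 0 < φ) (hφ₁ : φ < Real.pi / 2) (hθ : 0 < θ) {P : ℂ → ℂ}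
    (hP_series : ∀ᶠ z in 𝓝 (0 : ℂ),
      HasSum (fun j : ℕ => ((Θ (j + 1) / ((j + 1 : ℕ) : ℝ) : ℝ) : ℂ) * z ^ (j + 1)) (P z))
    (hP_hol : DifferentiableOn ℂ P (deltaDomain m M φ))
    (hP_sing : (fun z : ℂ => P z - ((θ : ℂ) * Complex.log (1 / (1 - z / (m : ℂ))) + (K : ℂ)))
      =O[𝓝[deltaDomain m M φ] (m : ℂ)] fun z : ℂ => ‖z - (m : ℂ)‖) {B : ℝ} (hB : 1 ≤ B) :
    ∃ (N : ℕ) (C : ℝ), 0 ≤ C ∧ ∀ n : ℕ, N ≤ n → ∀ w : ℂ, ‖w‖ ≤ B →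
      ‖probGenFun (weightedPerm Θ hΘ n).toMeasure numCycles w
          * Complex.exp (-(((θ * Real.log n + K + gammaConst θ : ℝ) : ℂ) * (w - 1)))
        - elemSeries (fun k => θ / (θ + k)) (w - 1)‖ ≤ C / n := by
  obtain ⟨N₁, A, hN₁, hA, hcoef⟩ := exists_norm_partitionSum_sub_le hm hmM hφ₀ hφ₁ hθ hP_series
    hP_hol hP_sing (B := B) (by linarith)
  obtain ⟨κ, hκ, hlow⟩ := exists_mul_rpow_le_prod_div_factorial hθ
  obtain ⟨C₁, hC₁, hX⟩ := exists_norm_ratio_mul_exp_sub_elemSeries_le hθ (B + 1)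
  obtain ⟨C₂, hC₂, hL⟩ := exists_norm_elemSeries_le hθ (B + 1)
  obtain ⟨N₂, hN₂⟩ := exists_nat_ge (2 * (A / κ))
  set γ := gammaConst θ with hγ
  set E := Real.exp ((1 + B) * |γ|) with hE
  refine ⟨max N₁ N₂, 2 * (C₁ + A / κ * E + A / κ * C₂), by positivity, fun n hn w hw => ?_⟩
  have hn1 : 1 ≤ n := hN₁.trans ((le_max_left _ _).trans hn)
  have hn0 : (0 : ℝ) < n := by exact_mod_cast hn1
  have hnN : N₁ ≤ n := (le_max_left _ _).trans hn
  have hw1 : ‖w - 1‖ ≤ B + 1 := (norm_sub_le _ _).trans (by rw [norm_one]; linarith)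
  set ρ : ℝ := (∏ k ∈ Finset.range n, (θ + k)) / n.factorial with hρ
  have hρlow : κ * (n : ℝ) ^ (θ - 1) ≤ ρ := hlow n hn1
  have hρ0 : 0 < ρ := lt_of_lt_of_le (by positivity) hρlow
  have hρne : (ρ : ℂ) ≠ 0 := by exact_mod_cast hρ0.ne'
  have hmne : (m : ℂ) ^ n ≠ 0 := pow_ne_zero _ (by exact_mod_cast hm.ne')
  have hfac : (n.factorial : ℂ) ≠ 0 := by exact_mod_cast n.factorial_ne_zero
  have hρC : (ρ : ℂ) = (∏ k ∈ Finset.range n, ((θ : ℂ) + k)) / n.factorial := by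
    rw [hρ]; push_cast; rfl
  set p : ℂ → ℂ := fun w => partitionSum (fun k => w * Θ k) n * (m : ℂ) ^ n
    * Complex.exp (-(w * K)) with hp
  set R : ℂ → ℂ := fun w => (∏ k ∈ Finset.range n, (w * θ + k)) / (n.factorial : ℂ) with hR
  have hR1 : R 1 = ρ := by rw [hR, hρC]; simp only [one_mul]
  set e : ℂ := Complex.exp (-(w - 1) * ((θ * Real.log n + γ : ℝ) : ℂ)) with he
  set X : ℂ := R w / ρ * e with hXdef
  set δ : ℂ := (p w - R w) / ρ * e with hδdef
  set η : ℂ := (p 1 - R 1) / ρ with hηdef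
  have hXL : ‖X - elemSeries (fun k => θ / (θ + k)) (w - 1)‖ ≤ C₁ / n := by
    have h := hX n w hn1 hw1
    have hratio : R w / ρ
        = (∏ k ∈ Finset.range n, (w * θ + k)) / (∏ k ∈ Finset.range n, ((θ : ℂ) + k)) := by
      rw [hρC, hR]
      exact div_div_div_cancel_right₀ hfac _ _
    rwa [hXdef, hratio]
  have hdiv : ∀ w : ℂ, ‖w‖ ≤ B → ‖(p w - R w) / ρ‖ ≤ A / κ * (n : ℝ) ^ (w.re * θ - θ - 1) := by
    intro w hw
    rw [norm_div, Complex.norm_real, Real.norm_of_nonneg hρ0.le, div_le_iff₀ hρ0]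
    refine (hcoef n hnN w hw).trans ?_
    calc A * (n : ℝ) ^ (w.re * θ - 2)
        = A / κ * (n : ℝ) ^ (w.re * θ - θ - 1) * (κ * (n : ℝ) ^ (θ - 1)) := by
          rw [show w.re * θ - 2 = (w.re * θ - θ - 1) + (θ - 1) by ring, Real.rpow_add hn0]
          field_simp
      _ ≤ _ := by gcongr
  -- The exponents `θ Re w - θ - 1` of the relative error and `θ - θ Re w` of the normalisation add
  -- up to `-1`, whatever `w` is.
  have hδ : ‖δ‖ ≤ A / κ * E / n := by
    rw [hδdef, norm_mul, he, norm_exp_neg_mul_log_add θ γ hn1]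
    have h1 : Real.exp ((1 - w.re) * γ) ≤ E := by
      refine Real.exp_le_exp.2 ((le_abs_self _).trans ?_)
      rw [abs_mul]
      have h2 := (Complex.abs_re_le_norm w).trans hw
      have h3 := abs_sub 1 w.re
      rw [abs_one] at h3
      gcongr
      linarith
    calc _ ≤ (A / κ * (n : ℝ) ^ (w.re * θ - θ - 1)) * ((n : ℝ) ^ (θ - w.re * θ) * E) :=
          mul_le_mul (hdiv w hw) (by gcongr) (by positivity) (by positivity)
      _ = A / κ * E * ((n : ℝ) ^ (w.re * θ - θ - 1) * (n : ℝ) ^ (θ - w.re * θ)) := by ring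
      _ = _ := by
          rw [← Real.rpow_add hn0, show w.re * θ - θ - 1 + (θ - w.re * θ) = -1 by ring,
            Real.rpow_neg_one, div_eq_mul_inv _ (n : ℝ)]
  have hη : ‖η‖ ≤ A / κ / n := by
    refine (hdiv 1 (by rwa [norm_one])).trans (le_of_eq ?_)
    rw [Complex.one_re, one_mul, sub_self, zero_sub, Real.rpow_neg_one, div_eq_mul_inv _ (n : ℝ)]
  have hηhalf : A / κ / n ≤ 1 / 2 := by
    have : (N₂ : ℝ) ≤ n := by exact_mod_cast (le_max_right N₁ N₂).trans hn
    rw [div_le_iff₀ hn0]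
    linarith
  have hkey : probGenFun (weightedPerm Θ hΘ n).toMeasure numCycles w
      * Complex.exp (-(((θ * Real.log n + K + γ : ℝ) : ℂ) * (w - 1))) = (X + δ) / (1 + η) := by
    have h1 : X + δ = p w / ρ * e := by rw [hXdef, hδdef]; ring
    have h2 : 1 + η = p 1 / ρ := by rw [hηdef, hR1]; field_simp; ring
    have h3 : Complex.exp (-(((θ * Real.log n + K + γ : ℝ) : ℂ) * (w - 1)))
        = e * Complex.exp (-(w * K)) / Complex.exp (-(1 * K)) := by
      rw [he, ← Complex.exp_add, ← Complex.exp_sub]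
      congr 1
      push_cast
      ring
    -- The denominator `b` need not be known to be nonzero: if it vanishes, both sides are `0` by
    -- the convention for division by zero.
    have halg : ∀ a b x y : ℂ, y ≠ 0 → a / b * (e * x / y)
        = a * (m : ℂ) ^ n * x / ρ * e / (b * (m : ℂ) ^ n * y / ρ) := by
      intro a b x y hy
      rcases eq_or_ne b 0 with rfl | hb
      · simp
      · field_simp
    rw [probGenFun_weightedPerm, h1, h2, h3]
    exact halg _ _ _ _ (Complex.exp_ne_zero _)
  rw [hkey]
  refine (norm_perturbed_ratio_sub_le hXL hδ hη hηhalf (hL _ hw1)).trans (le_of_eq ?_)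
  ring

theorem exists_norm_probGenFun_sub_elemSeries_le {Θ : ℕ → ℝ} (hΘ : ∀ k, 1 ≤ k → 0 < Θ k)
    {m M φ θ K : ℝ} (hm : 0 < m) (hmM : m < M)
    (hφ₀ : 0 < φ) (hφ₁ : φ < Real.pi / 2) (hθ : 0 < θ) {P : ℂ → ℂ}
    (hP_series : ∀ᶠ z in 𝓝 (0 : ℂ),
      HasSum (fun j : ℕ => ((Θ (j + 1) / ((j + 1 : ℕ) : ℝ) : ℝ) : ℂ) * z ^ (j + 1)) (P z))
    (hP_hol : DifferentiableOn ℂ P (deltaDomain m M φ))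
    (hP_sing : (fun z : ℂ => P z - ((θ : ℂ) * Complex.log (1 / (1 - z / (m : ℂ))) + (K : ℂ)))
      =O[𝓝[deltaDomain m M φ] (m : ℂ)] fun z : ℂ => ‖z - (m : ℂ)‖) (B : ℝ) :
    ∃ C : ℝ, ∀ n : ℕ, 1 ≤ n → ∀ w ∈ Metric.closedBall (0 : ℂ) B,
      ‖probGenFun (weightedPerm Θ hΘ n).toMeasure numCycles w
          * Complex.exp (-(((θ * Real.log n + K + gammaConst θ : ℝ) : ℂ) * (w - 1)))
        - elemSeries (fun k => θ / (θ + k)) (w - 1)‖ ≤ C / n := by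
  obtain ⟨N, C, hC, h⟩ := exists_norm_probGenFun_sub_elemSeries_le_of_le hΘ hm hmM hφ₀ hφ₁ hθ
    hP_series hP_hol hP_sing (le_max_right B 1)
  obtain ⟨C₂, hC₂, hL⟩ := exists_norm_elemSeries_le hθ (B + 1)
  have hfix : ∀ n : ℕ, ∃ C', ∀ w ∈ Metric.closedBall (0 : ℂ) B,
      ‖probGenFun (weightedPerm Θ hΘ n).toMeasure numCycles w
          * Complex.exp (-(((θ * Real.log n + K + gammaConst θ : ℝ) : ℂ) * (w - 1)))‖ ≤ C' := by
    refine fun n => (isCompact_closedBall _ _).exists_bound_of_continuousOn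
      (Continuous.continuousOn ?_)
    exact (continuous_probGenFun_weightedPerm Θ hΘ n).mul (by fun_prop)
  choose D hD using hfix
  have hterm : ∀ i : ℕ, 0 ≤ i * (|D i| + C₂) := fun i => by positivity
  -- The sum absorbs the finitely many `n < N`, where both terms are merely bounded; the factor `i`
  -- compensates the `1/n`.
  refine ⟨C + ∑ i ∈ Finset.range N, i * (|D i| + C₂), fun n hn w hw => ?_⟩
  have hn0 : (0 : ℝ) < n := by exact_mod_cast hn
  have hsum : 0 ≤ ∑ i ∈ Finset.range N, i * (|D i| + C₂) := Finset.sum_nonneg fun i _ => hterm i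
  have hwB : ‖w‖ ≤ B := by simpa using hw
  rcases lt_or_ge n N with hnN | hnN
  · have h1 : n * (|D n| + C₂) ≤ ∑ i ∈ Finset.range N, i * (|D i| + C₂) :=
      Finset.single_le_sum (f := fun i : ℕ => (i : ℝ) * (|D i| + C₂)) (fun i _ => hterm i)
        (Finset.mem_range.2 hnN)
    have hw1 : ‖w - 1‖ ≤ B + 1 := (norm_sub_le _ _).trans (by rw [norm_one]; linarith)
    refine (norm_sub_le _ _).trans ((add_le_add ((hD n w hw).trans (le_abs_self _))
      (hL _ hw1)).trans ?_)
    rw [le_div_iff₀ hn0]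
    linarith
  · refine (h n hnN w (hwB.trans (le_max_left _ _))).trans ?_
    gcongr
    linarith

theorem mainTheorem6
    (Θ : ℕ → ℝ) (hΘ : ∀ k, 1 ≤ k → 0 < Θ k)
    (m M φ θ K : ℝ) (hm : 0 < m) (hmM : m < M) (hφ₀ : 0 < φ) (hφ₁ : φ < Real.pi / 2)
    (hθ : 0 < θ)
    (P : ℂ → ℂ)
    (hP_series : ∀ᶠ z in 𝓝 (0 : ℂ),
      HasSum (fun j : ℕ => ((Θ (j + 1) / ((j + 1 : ℕ) : ℝ) : ℝ) : ℂ) * z ^ (j + 1)) (P z))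
    (hP_hol : DifferentiableOn ℂ P (deltaDomain m M φ))
    (hP_sing : (fun z : ℂ => P z - ((θ : ℂ) * Complex.log (1 / (1 - z / (m : ℂ))) + (K : ℂ)))
      =O[𝓝[deltaDomain m M φ] (m : ℂ)] fun z : ℂ => ‖z - (m : ℂ)‖) :
    Summable (gammaTerm θ) ∧
    gammaConst 1 = Real.eulerMascheroniConstant ∧
    ModPoissonBernoulli (fun n => (weightedPerm Θ hΘ n).toMeasure) (fun _ σ => numCycles σ)
      (fun n => θ * Real.log n + K + gammaConst θ) (fun k => θ / (θ + k)) ∧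
    ∀ S : Set ℂ, IsCompact S → ∃ C : ℝ, ∀ n : ℕ, 1 ≤ n → ∀ w ∈ S,
      ‖probGenFun (weightedPerm Θ hΘ n).toMeasure numCycles w
          * Complex.exp (-(((θ * Real.log n + K + gammaConst θ : ℝ) : ℂ) * (w - 1)))
        - elemSeries (fun k => θ / (θ + k)) (w - 1)‖ ≤ C / n := by
  have hbound := exists_norm_probGenFun_sub_elemSeries_le hΘ hm hmM hφ₀ hφ₁ hθ hP_series hP_hol
    hP_sing
  -- The radius `2` is arbitrary: the bound holds on every disc.
  refine ⟨summable_gammaTerm hθ, gammaConst_one,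
    ⟨fun n => measurable_from_top, summable_sq_div_add hθ, 2, one_lt_two, fun n w _ => ?_, ?_⟩,
    fun S hS => ?_⟩
  · exact Integrable.of_finite
  · obtain ⟨C, hC⟩ := hbound 2
    refine TendstoUniformlyOn.tendstoLocallyUniformlyOn (Metric.tendstoUniformlyOn_iff.2 ?_)
    intro ε hε
    have ht : Tendsto (fun n : ℕ => C / (n : ℝ)) atTop (𝓝 0) :=
      tendsto_const_div_atTop_nhds_zero_nat C
    filter_upwards [ht.eventually (gt_mem_nhds hε), eventually_ge_atTop 1] with n hn hn1 w hw
    rw [dist_comm, dist_eq_norm]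
    exact (hC n hn1 w (Metric.ball_subset_closedBall hw)).trans_lt hn
  · obtain ⟨B, hB⟩ := hS.isBounded.subset_closedBall 0
    obtain ⟨C, hC⟩ := hbound B
    exact ⟨C, fun n hn w hw => hC n hn w (hB hw)⟩
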